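/- Let $d\ge 1$, let $\mathbb T^d=\mathbb R^d/\mathbb Z^d$ carry its Lebesgue probability measure $dx$, and write $\langle f\rangle=\int_{\mathbb T^d}f\,dx$. Let $v:\mathbb T^d\to\mathbb R^d$ be Lipschitz with $\operatorname{div}v=0$, and let $\phi:\mathbb T^d\to\mathbb R$ be integrable with $\phi\ge 0$ a.e. and $\langle\phi\rangle>0$. Let $\{\psi_t\}_{t\in\mathbb R}$ be the flow of $v$ on $\mathbb T^d$, i.e. $\partial_t\psi_t(x)=v(\psi_t(x))$, $\psi_0(x)=x$. The flow is *ergodic* if every Borel set $A$ with $\psi_t(A)=A$ for all $t\in\mathbb R$ has measure $0$ or $1$, and *uniquely ergodic* if it has exactly one invariant Borel probability measure. Let $$\phi_\star(x)=\lim_{t\to+\infty}\frac1t\int_0^t\phi(\psi_\tau(x))\,d\tau ,$$ which exists for a.e. $x$. For $\theta_0\in L^p(\mathbb T^d)$ let $\theta$ be a weak solution of $$\partial_t\theta+v\cdot\nabla\theta=-\phi\,\theta\quad\text{on }[0,\infty)\times\mathbb T^d,\qquad \theta(0)=\theta_0,$$ meaning that $\theta(t)\in L^1(\mathbb T^d)$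 for all $t\ge0$, that $\theta$ and $\phi\theta$ are integrable on $(0,T)\times\mathbb T^d$ for all $T>0$, and that for all $\chi\in C^\infty(\mathbb T^d)$ and all $t\ge 0$ $$\int_{\mathbb T^d}\theta(t)\chi\,dx=\int_{\mathbb T^d}\theta_0\chi\,dx+\int_0^t\!\int_{\mathbb T^d}\big(\theta(s)\,v\cdot\nabla\chi-\phi\,\theta(s)\,\chi\big)\,dx\,ds .$$ Then: (i) If the flow is ergodic, then for every $p\in[1,\infty)$, every $\theta_0\in L^p(\mathbb T^d)$ and every such $\theta$, $\lim_{t\to+\infty}\|\theta(t)\|_{L^p}=0$. (ii) If the flow is uniquely ergodic and $\phi$ is continuous, then for every $\mu\in[0,\langle\phi\rangle)$ there is $T_0>0$ such that for every $p\in[1,\infty]$, every $\theta_0\in L^p(\mathbb T^d)$ and every such $\theta$, $$\|\theta(t)\|_{L^p}\le\|\theta_0\|_{L^p}\,e^{-\mu t}\qquad\text{for all }t\ge T_0 .$$ (iii) If $\phi_\star(x)>0$ for a.e. $x$, then (without assuming ergodicity) for every $p\in[1,\infty)$, every $\theta_0\in L^p(\mathbb T^d)$ and every such $\theta$, $\lim_{t\to+\infty}\|\theta(t)\|_{L^p}=0$.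 -/

import Mathlib

open MeasureTheory Filter Topology
open scoped ENNReal NNReal ContDiff

noncomputable section

namespace DampedTransport

/-- The torus `ℝᵈ / ℤᵈ`; its `volume` is the normalized Lebesgue measure (total mass one). -/
abbrev Torus (d : ℕ) : Type := UnitAddTorus (Fin d)

/-- The natural projection `ℝᵈ → ℝᵈ / ℤᵈ`. -/
def proj {d : ℕ} (y : Fin d → ℝ) : Torus d := fun i => (y i : UnitAddCircle)

/-- A function on the torus is smooth when its periodic lift to `ℝᵈ` is `C^∞`. -/
def Smooth {d : ℕ} (χ : Torus d → ℝ) : Prop :=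
  ContDiff ℝ ∞ (fun y : Fin d → ℝ => χ (proj y))

/-- The partial derivative `∂ᵢ χ` at a point of the torus. -/
def partialDeriv {d : ℕ} (i : Fin d) (χ : Torus d → ℝ) (x : Torus d) : ℝ :=
  deriv (fun s : ℝ => χ (x + Pi.single i (s : UnitAddCircle))) 0

/-- The directional derivative `v · ∇χ`. -/
def advect {d : ℕ} (v : Torus d → Fin d → ℝ) (χ : Torus d → ℝ) (x : Torus d) : ℝ :=
  ∑ i, v x i * partialDeriv i χ x

/-- `div v = 0`, in the sense of distributions on the torus. For a Lipschitz field this is the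
same as the vanishing of the pointwise divergence almost everywhere. -/
def DivergenceFree {d : ℕ} (v : Torus d → Fin d → ℝ) : Prop :=
  ∀ χ : Torus d → ℝ, Smooth χ → (∫ x, advect v χ x) = 0

/-- `X` is a global orbit in `ℝᵈ` of the (lifted) field `v`: it solves `X' = v(X)` on `ℝ`. -/
def IsOrbit {d : ℕ} (v : Torus d → Fin d → ℝ) (X : ℝ → Fin d → ℝ) : Prop :=
  ∀ t : ℝ, HasDerivAt X (v (proj (X t))) t

open Classical in
/-- The flow `ψ_t` of `v` on the torus: the projection of the orbit in `ℝᵈ` starting above `x`.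
For a Lipschitz field such an orbit exists and its projection is unique, so that the
default value `x` and the choice of the orbit play no role. -/
def flow {d : ℕ} (v : Torus d → Fin d → ℝ) (t : ℝ) (x : Torus d) : Torus d :=
  if h : ∃ X : ℝ → Fin d → ℝ, IsOrbit v X ∧ proj (X 0) = x then proj (h.choose t) else x

/-- Ergodicity of a one-parameter flow with respect to the Lebesgue measure: any (Borel) set `A`
with `ψ_t(A) = A` for all real `t` has zero measure or full measure. -/
def ErgodicFlow {d : ℕ} (ψ : ℝ → Torus d → Torus d) : Prop :=
  ∀ A : Set (Torus d), MeasurableSet A → (∀ t : ℝ, ψ t '' A = A) →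
    volume A = 0 ∨ volume A = 1

/-- Unique ergodicity: there is exactly one Borel probability measure invariant by the flow. -/
def UniquelyErgodicFlow {d : ℕ} (ψ : ℝ → Torus d → Torus d) : Prop :=
  ∃! m : Measure (Torus d), IsProbabilityMeasure m ∧ ∀ t : ℝ, MeasurePreserving (ψ t) m m

/-- The Birkhoff limit `φ_⋆(x) = lim_{t → +∞} (1/t) ∫₀ᵗ φ(ψ_τ(x)) dτ` (an arbitrary value where
there is no limit, which for integrable `φ` and a measure-preserving flow concerns only a null
set). -/
def birkhoffLimit {d : ℕ} (ψ : ℝ → Torus d → Torus d) (φ : Torus d → ℝ) (x : Torus d) : ℝ :=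
  limUnder atTop (fun t : ℝ => (1 / t) * ∫ τ in (0 : ℝ)..t, φ (ψ τ x))

/-- `θ` is a weak (distributional) solution on `[0, ∞) × 𝕋ᵈ` of
`∂ₜθ + v · ∇θ = -φ θ`, `θ(0) = θ₀`, for a divergence-free field `v`.
All terms are only required to be integrable (locally in time), and the equation tested against
`χ` is integrated over `[0, t]` for every `t ≥ 0`; this singles out the representative of `θ`
that is weakly continuous in time, for which the norms of `θ(t)` make sense at every time. -/
structure IsWeakSolution {d : ℕ} (v : Torus d → Fin d → ℝ) (φ : Torus d → ℝ)
    (θ₀ : Torus d → ℝ) (θ : ℝ → Torus d → ℝ) : Prop where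
  integrable_slice : ∀ t : ℝ, 0 ≤ t → Integrable (θ t)
  integrable : ∀ T : ℝ, 0 < T →
    Integrable (fun z : ℝ × Torus d => θ z.1 z.2)
      ((volume.restrict (Set.Ioc 0 T)).prod volume)
  integrable_damping : ∀ T : ℝ, 0 < T →
    Integrable (fun z : ℝ × Torus d => φ z.2 * θ z.1 z.2)
      ((volume.restrict (Set.Ioc 0 T)).prod volume)
  weak_eq : ∀ χ : Torus d → ℝ, Smooth χ → ∀ t : ℝ, 0 ≤ t →
    (∫ x, θ t x * χ x) =
      (∫ x, θ₀ x * χ x) +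
        ∫ s in (0 : ℝ)..t, ∫ x, (θ s x * advect v χ x - φ x * θ s x * χ x)

end DampedTransport

end

noncomputable section

namespace DampedTransport

variable {d : ℕ} {v : Torus d → Fin d → ℝ} {K : ℝ≥0}

/-! ### The projection onto the torus -/

/-! Everything rests on the formula `θ T (ψ_T x) = θ₀ x * exp (-∫₀ᵀ φ (ψ_s x) ds)` for a.e. `x`,
valid for every weak solution (`IsWeakSolution.ae_eq_exp`). Since `ψ_T` preserves the volume, the
`Lᵖ` norm of `θ T` is that of the right-hand side, and only the growth of the accumulated damping
`∫₀ᵀ φ (ψ_s x) ds` matters. If it tends to infinity a.e., dominated convergence gives (i) and (iii)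
(`IsWeakSolution.tendsto_eLpNorm`); if it is at least `μ T` for all `x`, (ii) follows pointwise
(`IsWeakSolution.eLpNorm_le`).

To obtain the formula one wants to test the equation against `χ ∘ ψ_{-t}`, whose transport
derivative vanishes. This function is only Lipschitz in space and depends on time. The first defect
is removed by mollifying: a commutator estimate (`abs_advect_mollify_sub_le`) admits any Lipschitz
test function with a Lipschitz derivative along the flow. The second is removed by freezing the test
function on short time intervals: the error on each is its length times an additive mass
(`abs_increment_le`), so it disappears under refinement (`eq_flow`). With `φ = 0` and `θ = 1` the
same identity shows that the flow preserves the volume. A change of variables then turns it into a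
scalar linear integral equation along almost every orbit, solved by `linear_integral_equation`.

The damping blows up for these reasons. In (iii), a bounded accumulated damping would have time
averages tending to zero. In (i), the points whose forward orbit collects finite mass of `min φ 1`
form an invariant set; it cannot have full measure, because time averages would then tend to zero
while their space mean stays fixed and positive. In (ii), a failure of the uniform bound produces,
by the Krylov–Bogoliubov argument, an invariant probability measure other than the volume. -/

lemma proj_add (y z : Fin d → ℝ) : proj (y + z) = proj y + proj z := by
  ext i; simp [proj]

lemma proj_sub (y z : Fin d → ℝ) : proj (y - z) = proj y - proj z := by
  ext i; simp [proj]

@[simp] lemma proj_zero : proj (0 : Fin d → ℝ) = 0 := by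
  ext i; simp [proj]

lemma proj_single (i : Fin d) (s : ℝ) :
    proj (Pi.single i s : Fin d → ℝ) = Pi.single i (s : UnitAddCircle) := by
  ext j
  by_cases h : j = i
  · subst h; simp [proj]
  · simp [proj, Pi.single_eq_of_ne h]

lemma norm_proj_le (y : Fin d → ℝ) : ‖proj y‖ ≤ ‖y‖ := by
  refine (pi_norm_le_iff_of_nonneg (norm_nonneg _)).2 fun i => ?_
  refine le_trans ?_ (norm_le_pi_norm y i)
  simp only [proj, UnitAddCircle.norm_eq, Real.norm_eq_abs]
  simpa using round_le (y i) 0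

lemma lipschitzWith_proj : LipschitzWith 1 (proj : (Fin d → ℝ) → Torus d) :=
  LipschitzWith.of_dist_le_mul fun y z => by
    rw [dist_eq_norm, dist_eq_norm, ← proj_sub]
    simpa using norm_proj_le (y - z)

lemma continuous_proj : Continuous (proj : (Fin d → ℝ) → Torus d) :=
  lipschitzWith_proj.continuous

/-- Subtracting the nearest integer in each coordinate realises the quotient norm. Points of the
torus can thus be lifted to `ℝᵈ` at exactly their torus distance, which transfers Lipschitz bounds
from `ℝᵈ` downstairs. -/
lemma exists_proj_eq (x : Torus d) : ∃ y : Fin d → ℝ, proj y = x ∧ ‖y‖ = ‖x‖ := by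
  choose z hz using fun i => QuotientAddGroup.mk_surjective (x i)
  have hz' : ∀ i, ((z i : ℝ) : UnitAddCircle) = x i := hz
  have h : ∀ i, ((z i - round (z i) : ℝ) : UnitAddCircle) = x i := fun i => by
    rw [AddCircle.coe_sub, hz' i]
    have : ((round (z i) : ℝ) : UnitAddCircle) = 0 := by
      rw [AddCircle.coe_eq_zero_iff]
      exact ⟨round (z i), by simp⟩
    rw [this, sub_zero]
  have hn : ∀ i, ‖x i‖ = ‖z i - round (z i)‖ := fun i => by
    rw [← hz' i, UnitAddCircle.norm_eq, Real.norm_eq_abs]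
  refine ⟨fun i => z i - round (z i), funext h, ?_⟩
  simp only [Pi.norm_def]
  congr 2
  ext i
  simpa using (hn i).symm

lemma proj_surjective : Function.Surjective (proj : (Fin d → ℝ) → Torus d) := fun x =>
  (exists_proj_eq x).imp fun _ h => h.1

lemma exists_proj_add (x z : Torus d) (y : Fin d → ℝ) (hy : proj y = x) :
    ∃ y', proj y' = z ∧ ‖y' - y‖ = dist z x := by
  obtain ⟨k, hk, hn⟩ := exists_proj_eq (z - x)
  exact ⟨y + k, by rw [proj_add, hk, hy]; abel, by simp [hn, dist_eq_norm]⟩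

/-! ### Orbits of a Lipschitz field -/

lemma exists_norm_le (hv : LipschitzWith K v) : ∃ M : ℝ≥0, ∀ x, ‖v x‖ ≤ M := by
  obtain ⟨C, hC⟩ := isCompact_univ.exists_bound_of_continuousOn hv.continuous.continuousOn
  exact ⟨C.toNNReal, fun x => (hC x trivial).trans (Real.le_coe_toNNReal C)⟩

lemma lipschitzWith_lift (hv : LipschitzWith K v) :
    LipschitzWith K (fun y : Fin d → ℝ => v (proj y)) := by
  simpa using! hv.comp lipschitzWith_proj

/-- The field is bounded by some `M`, so Picard–Lindelöf applies on all of `[-n, n]` with a ball of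
radius `M * n`. Uniqueness lets these solutions be glued. -/
lemma exists_orbit (hv : LipschitzWith K v) (y : Fin d → ℝ) :
    ∃ X : ℝ → Fin d → ℝ, IsOrbit v X ∧ X 0 = y := by
  obtain ⟨M, hM⟩ := exists_norm_le hv
  have hloc : ∀ n : ℕ, ∃ α : ℝ → Fin d → ℝ, α 0 = y ∧
      ∀ t ∈ Set.Ioo (-(n : ℝ)) n, HasDerivAt α (v (proj (α t))) t := fun n => by
    have h0 : (0 : ℝ) ∈ Set.Icc (-(n : ℝ)) n := by simp
    have hpl : IsPicardLindelof (fun _ : ℝ => fun z : Fin d → ℝ => v (proj z))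
        (⟨0, h0⟩ : Set.Icc (-(n : ℝ)) n) y (M * n) 0 M K :=
      IsPicardLindelof.of_time_independent (fun x _ => hM _)
        (lipschitzWith_lift hv).lipschitzOnWith (by simp)
    obtain ⟨α, hα0, hα⟩ := hpl.exists_eq_forall_mem_Icc_hasDerivWithinAt₀
    exact ⟨α, hα0, fun t ht => (hα t (Set.Ioo_subset_Icc_self ht)).hasDerivAt
      (Icc_mem_nhds ht.1 ht.2)⟩
  choose α hα0 hα using hloc
  have hagree : ∀ n m : ℕ, n ≤ m → ∀ t ∈ Set.Ioo (-(n : ℝ)) n, α n t = α m t := by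
    intro n m hnm t ht
    have hn : (0 : ℝ) ∈ Set.Ioo (-(n : ℝ)) n := by
      constructor <;> linarith [ht.1, ht.2]
    have hnm' : (n : ℝ) ≤ m := by exact_mod_cast hnm
    exact ODE_solution_unique_of_mem_Ioo (v := fun _ z => v (proj z)) (s := fun _ => Set.univ)
      (fun _ _ => (lipschitzWith_lift hv).lipschitzOnWith) hn
      (fun s hs => ⟨hα n s hs, trivial⟩)
      (fun s hs => ⟨hα m s ⟨by linarith [hs.1], by linarith [hs.2]⟩, trivial⟩)
      (by rw [hα0, hα0]) ht
  have hmem : ∀ s : ℝ, s ∈ Set.Ioo (-((⌈|s|⌉₊ + 1 : ℕ) : ℝ)) ((⌈|s|⌉₊ + 1 : ℕ) : ℝ) := by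
    intro s
    refine abs_lt.1 ?_
    push_cast
    linarith [Nat.le_ceil |s|]
  -- The index `⌈|t|⌉₊ + 1` places `t` strictly inside its interval, where the derivative is
  -- two-sided.
  refine ⟨fun t => α (⌈|t|⌉₊ + 1) t, fun t => ?_, hα0 _⟩
  refine (hα _ t (hmem t)).congr_of_eventuallyEq ?_
  filter_upwards [Ioo_mem_nhds (hmem t).1 (hmem t).2] with s hs
  rcases le_total (⌈|s|⌉₊ + 1) (⌈|t|⌉₊ + 1) with h | h
  · exact hagree _ _ h s (hmem s)
  · exact (hagree _ _ h s hs).symm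

lemma IsOrbit.unique (hv : LipschitzWith K v) {X Y : ℝ → Fin d → ℝ} (hX : IsOrbit v X)
    (hY : IsOrbit v Y) (h : X 0 = Y 0) : X = Y :=
  ODE_solution_unique_univ (v := fun _ z => v (proj z)) (s := fun _ => Set.univ)
    (fun _ => (lipschitzWith_lift hv).lipschitzOnWith) (fun t => ⟨hX t, trivial⟩)
    (fun t => ⟨hY t, trivial⟩) h

lemma IsOrbit.continuous {X : ℝ → Fin d → ℝ} (hX : IsOrbit v X) : Continuous X :=
  continuous_iff_continuousAt.2 fun t => (hX t).continuousAt

lemma IsOrbit.shift {X : ℝ → Fin d → ℝ} (hX : IsOrbit v X) (s : ℝ) :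
    IsOrbit v (fun t => X (t + s)) := fun t => (hX (t + s)).comp_add_const t s

lemma IsOrbit.translate {X : ℝ → Fin d → ℝ} (hX : IsOrbit v X) {k : Fin d → ℝ}
    (hk : proj k = 0) : IsOrbit v (fun t => X t + k) := fun t => by
  simpa [proj_add, hk] using (hX t).add_const k

lemma IsOrbit.reverse {X : ℝ → Fin d → ℝ} (hX : IsOrbit v X) :
    IsOrbit (fun x => -v x) (fun t => X (-t)) := fun t => by
  simpa using! (hX (-t)).scomp t (hasDerivAt_neg t)

/-- The orbit selected by `choose` starts at a lattice translate of `X 0`. The lifted field is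
periodic, so by uniqueness the two orbits remain that translate apart and have the same projection.
-/
lemma flow_proj (hv : LipschitzWith K v) {X : ℝ → Fin d → ℝ} (hX : IsOrbit v X) (t : ℝ) :
    flow v t (proj (X 0)) = proj (X t) := by
  have h : ∃ Y : ℝ → Fin d → ℝ, IsOrbit v Y ∧ proj (Y 0) = proj (X 0) := ⟨X, hX, rfl⟩
  rw [flow, dif_pos h]
  have hk : proj (X 0 - h.choose 0) = 0 := by
    rw [proj_sub, h.choose_spec.2, sub_self]
  have := (h.choose_spec.1.translate hk).unique hv hX (by simp)
  rw [← congrFun this t, proj_add, hk, add_zero]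

lemma exists_orbit_over (hv : LipschitzWith K v) (x : Torus d) :
    ∃ X : ℝ → Fin d → ℝ, IsOrbit v X ∧ ∀ t, flow v t x = proj (X t) := by
  obtain ⟨y, rfl⟩ := proj_surjective x
  obtain ⟨X, hX, rfl⟩ := exists_orbit hv y
  exact ⟨X, hX, flow_proj hv hX⟩

/-! ### The flow on the torus -/

lemma flow_zero (hv : LipschitzWith K v) (x : Torus d) : flow v 0 x = x := by
  obtain ⟨y, rfl⟩ := proj_surjective x
  obtain ⟨X, hX, rfl⟩ := exists_orbit hv y
  exact flow_proj hv hX 0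

lemma flow_add (hv : LipschitzWith K v) (t s : ℝ) (x : Torus d) :
    flow v (t + s) x = flow v t (flow v s x) := by
  obtain ⟨X, hX, h⟩ := exists_orbit_over hv x
  rw [h, h]
  have := flow_proj hv (hX.shift s) t
  rw [zero_add] at this
  exact this.symm

lemma flow_neg_flow (hv : LipschitzWith K v) (t : ℝ) (x : Torus d) :
    flow v (-t) (flow v t x) = x := by
  rw [← flow_add hv, neg_add_cancel, flow_zero hv]

lemma flow_flow_neg (hv : LipschitzWith K v) (t : ℝ) (x : Torus d) :
    flow v t (flow v (-t) x) = x := by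
  rw [← flow_add hv, add_neg_cancel, flow_zero hv]

lemma IsOrbit.dist_le_of_nonneg (hv : LipschitzWith K v) {X Y : ℝ → Fin d → ℝ} (hX : IsOrbit v X)
    (hY : IsOrbit v Y) {t : ℝ} (ht : 0 ≤ t) :
    dist (X t) (Y t) ≤ dist (X 0) (Y 0) * Real.exp (K * t) := by
  simpa using dist_le_of_trajectories_ODE (v := fun _ z => v (proj z)) (a := 0) (b := t)
    (fun _ => lipschitzWith_lift hv) hX.continuous.continuousOn
    (fun s _ => (hX s).hasDerivWithinAt) hY.continuous.continuousOn
    (fun s _ => (hY s).hasDerivWithinAt) le_rfl t ⟨ht, le_rfl⟩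

lemma IsOrbit.dist_le (hv : LipschitzWith K v) {X Y : ℝ → Fin d → ℝ} (hX : IsOrbit v X)
    (hY : IsOrbit v Y) (t : ℝ) :
    dist (X t) (Y t) ≤ Real.exp (K * |t|) * dist (X 0) (Y 0) := by
  rw [mul_comm]
  rcases le_total 0 t with ht | ht
  · simpa [abs_of_nonneg ht] using hX.dist_le_of_nonneg hv hY ht
  · have hv' : LipschitzWith K (fun x => -v x) := hv.neg
    simpa [abs_of_nonpos ht] using
      hX.reverse.dist_le_of_nonneg hv' hY.reverse (t := -t) (by linarith)

lemma lipschitzWith_flow (hv : LipschitzWith K v) (t : ℝ) :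
    LipschitzWith (Real.toNNReal (Real.exp (K * |t|))) (flow v t) :=
  LipschitzWith.of_dist_le_mul fun x z => by
    obtain ⟨y, rfl⟩ := proj_surjective x
    obtain ⟨y', rfl, hy'⟩ := exists_proj_add (proj y) z y rfl
    obtain ⟨X, hX, rfl⟩ := exists_orbit hv y
    obtain ⟨Y, hY, rfl⟩ := exists_orbit hv y'
    rw [flow_proj hv hX, flow_proj hv hY, Real.coe_toNNReal _ (Real.exp_pos _).le,
      dist_comm (proj (X 0)), ← hy', ← dist_eq_norm, dist_comm (Y 0)]
    refine le_trans ?_ (hX.dist_le hv hY t)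
    simpa using lipschitzWith_proj.dist_le_mul (X t) (Y t)

lemma continuous_flow (hv : LipschitzWith K v) (t : ℝ) : Continuous (flow v t) :=
  (lipschitzWith_flow hv t).continuous

lemma IsOrbit.lipschitzWith {M : ℝ≥0} (hM : ∀ x, ‖v x‖ ≤ M) {X : ℝ → Fin d → ℝ}
    (hX : IsOrbit v X) : LipschitzWith M X :=
  lipschitzWith_of_nnnorm_deriv_le (fun t => (hX t).differentiableAt)
    fun t => by rw [(hX t).deriv]; exact hM _

lemma dist_flow_flow_le (hv : LipschitzWith K v) {M : ℝ≥0} (hM : ∀ x, ‖v x‖ ≤ M) (t s : ℝ)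
    (x : Torus d) : dist (flow v t x) (flow v s x) ≤ M * |t - s| := by
  obtain ⟨X, hX, h⟩ := exists_orbit_over hv x
  rw [h, h]
  calc dist (proj (X t)) (proj (X s)) ≤ dist (X t) (X s) := by
        simpa using lipschitzWith_proj.dist_le_mul (X t) (X s)
    _ ≤ M * |t - s| := (hX.lipschitzWith hM).dist_le_mul t s

lemma continuous_flow_uncurry (hv : LipschitzWith K v) :
    Continuous (fun z : ℝ × Torus d => flow v z.1 z.2) := by
  obtain ⟨M, hM⟩ := exists_norm_le hv
  refine continuous_prod_of_continuous_lipschitzWith _ M (fun t => continuous_flow hv t) ?_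
  exact fun x => LipschitzWith.of_dist_le_mul fun t s => dist_flow_flow_le hv hM t s x

/-- Mean value inequality for `X s - s • X' 0`, whose derivative is at most `C * |t|` between `0`
and `t`. It supplies all quadratic remainders along orbits. -/
lemma norm_sub_le_sq {E : Type*} [NormedAddCommGroup E] [NormedSpace ℝ E] {X X' : ℝ → E} {C : ℝ}
    (hX : ∀ t, HasDerivAt X (X' t) t) (h : ∀ t, ‖X' t - X' 0‖ ≤ C * |t|) (hC : 0 ≤ C) (t : ℝ) :
    ‖X t - X 0 - t • X' 0‖ ≤ C * t ^ 2 := by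
  have key := Convex.norm_image_sub_le_of_norm_hasDerivWithin_le (f := fun s => X s - s • X' 0)
    (f' := fun s => X' s - X' 0) (s := Set.uIcc 0 t) (x := 0) (y := t) (C := C * |t|)
    (fun s _ => by
      simpa using! ((hX s).sub ((hasDerivAt_id s).smul_const (X' 0))).hasDerivWithinAt)
    (fun s hs => (h s).trans <| mul_le_mul_of_nonneg_left
      (by simpa using Set.abs_sub_left_of_mem_uIcc hs) hC)
    (convex_uIcc 0 t) Set.left_mem_uIcc Set.right_mem_uIcc
  have e : X t - t • X' 0 - (X 0 - (0 : ℝ) • X' 0) = X t - X 0 - t • X' 0 := by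
    rw [zero_smul]; abel
  rw [e] at key
  simpa [mul_assoc, ← pow_two] using key

lemma dist_flow_add_le (hv : LipschitzWith K v) {M : ℝ≥0} (hM : ∀ x, ‖v x‖ ≤ M) (h : ℝ)
    (x : Torus d) : dist (flow v h x) (x + proj (h • v x)) ≤ K * M * h ^ 2 := by
  obtain ⟨y, rfl⟩ := proj_surjective x
  obtain ⟨X, hX, rfl⟩ := exists_orbit hv y
  rw [flow_proj hv hX, ← proj_add]
  calc dist (proj (X h)) (proj (X 0 + h • v (proj (X 0))))
      ≤ dist (X h) (X 0 + h • v (proj (X 0))) := by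
        simpa using lipschitzWith_proj.dist_le_mul (X h) (X 0 + h • v (proj (X 0)))
    _ = ‖X h - X 0 - h • v (proj (X 0))‖ := by rw [dist_eq_norm, sub_sub]
    _ ≤ _ := norm_sub_le_sq hX (fun t => by
        have h1 := (lipschitzWith_lift hv).dist_le_mul (X t) (X 0)
        have h2 := (hX.lipschitzWith hM).dist_le_mul t 0
        rw [dist_eq_norm] at h1
        refine h1.trans ?_
        rw [mul_assoc]
        gcongr
        simpa using h2) (by positivity) h

/-! ### Smooth functions on the torus -/

/-- Every class has a representative of norm at most `1 / 2`, so all values are attained on a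
compact ball. -/
lemma exists_norm_le_of_periodic {E : Type*} [NormedAddCommGroup E] {f : (Fin d → ℝ) → E}
    (hf : Continuous f) (hper : ∀ y k, proj k = 0 → f (y + k) = f y) : ∃ C, ∀ y, ‖f y‖ ≤ C := by
  obtain ⟨C, hC⟩ := (isCompact_closedBall (0 : Fin d → ℝ) 1).exists_bound_of_continuousOn
    hf.continuousOn
  refine ⟨C, fun y => ?_⟩
  obtain ⟨z, hz, hn⟩ := exists_proj_eq (proj y)
  have : f y = f z := by
    have := hper z (y - z) (by rw [proj_sub, hz, sub_self])
    simpa using this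
  rw [this]
  refine hC z ?_
  rw [mem_closedBall_zero_iff, hn]
  refine (pi_norm_le_iff_of_nonneg zero_le_one).2 fun i => ?_
  exact (AddCircle.norm_le_half_period 1 one_ne_zero).trans (by norm_num)

lemma Smooth.exists_lipschitzWith {χ : Torus d → ℝ} (hχ : Smooth χ) :
    ∃ L : ℝ≥0, LipschitzWith L χ := by
  obtain ⟨C, hC⟩ := exists_norm_le_of_periodic (hχ.continuous_fderiv (by simp)) fun y k hk => by
    have e : (fun z : Fin d → ℝ => χ (proj (z + k))) = fun z => χ (proj z) := by
      funext z; rw [proj_add, hk, add_zero]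
    have := fderiv_comp_add_right (𝕜 := ℝ) (f := fun z : Fin d → ℝ => χ (proj z)) (x := y) k
    rw [← this, e]
  have hL : LipschitzWith C.toNNReal (fun y : Fin d → ℝ => χ (proj y)) :=
    lipschitzWith_of_nnnorm_fderiv_le (hχ.differentiable (by simp))
      fun y => by
        rw [← NNReal.coe_le_coe]
        exact (hC y).trans (Real.le_coe_toNNReal C)
  refine ⟨C.toNNReal, LipschitzWith.of_dist_le_mul fun x z => ?_⟩
  obtain ⟨y, rfl⟩ := proj_surjective x
  obtain ⟨y', rfl, hy'⟩ := exists_proj_add (proj y) z y rfl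
  rw [dist_comm (proj y), ← hy', ← dist_eq_norm, dist_comm y']
  exact hL.dist_le_mul y y'

lemma Smooth.continuous {χ : Torus d → ℝ} (hχ : Smooth χ) : Continuous χ :=
  hχ.exists_lipschitzWith.choose_spec.continuous

lemma partialDeriv_proj {χ : Torus d → ℝ} (hχ : Smooth χ) (i : Fin d) (y : Fin d → ℝ) :
    partialDeriv i χ (proj y) =
      fderiv ℝ (fun z : Fin d → ℝ => χ (proj z)) y (Pi.single i 1) := by
  have hd : HasFDerivAt (fun z : Fin d → ℝ => χ (proj z)) _ (y + (0 : ℝ) • Pi.single i 1) :=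
    (hχ.differentiable (by simp) _).hasFDerivAt
  have h1 : HasDerivAt (fun s : ℝ => y + s • (Pi.single i 1 : Fin d → ℝ)) (Pi.single i 1) 0 := by
    simpa using ((hasDerivAt_id (0 : ℝ)).smul_const (Pi.single i 1 : Fin d → ℝ)).const_add y
  have h2 := (hd.comp_hasDerivAt (0 : ℝ) h1).deriv
  rw [zero_smul, add_zero] at h2
  rw [← h2, partialDeriv]
  congr 1
  funext s
  simp [proj_add, ← proj_single, ← Pi.single_smul']

lemma Smooth.partialDeriv {χ : Torus d → ℝ} (hχ : Smooth χ) (i : Fin d) :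
    Smooth (partialDeriv i χ) := by
  have h : ContDiff ℝ ∞ (fderiv ℝ (fun z : Fin d → ℝ => χ (proj z))) :=
    hχ.fderiv_right (by simp)
  have h' := h.clm_apply (contDiff_const (c := (Pi.single i 1 : Fin d → ℝ)))
  unfold Smooth
  simpa only [partialDeriv_proj hχ] using h'

lemma advect_proj {χ : Torus d → ℝ} (hχ : Smooth χ) (y : Fin d → ℝ) :
    advect v χ (proj y) = fderiv ℝ (fun z : Fin d → ℝ => χ (proj z)) y (v (proj y)) := by
  conv_rhs => rw [pi_eq_sum_univ' (v (proj y)), map_sum]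
  refine Finset.sum_congr rfl fun i _ => ?_
  rw [partialDeriv_proj hχ, ← smul_eq_mul, ← map_smul]

lemma exists_lipschitzWith_mul {X : Type*} [PseudoMetricSpace X] [CompactSpace X] {f g : X → ℝ}
    (hf : ∃ L : ℝ≥0, LipschitzWith L f) (hg : ∃ L : ℝ≥0, LipschitzWith L g) :
    ∃ L : ℝ≥0, LipschitzWith L (fun x => f x * g x) := by
  obtain ⟨L, hf⟩ := hf
  obtain ⟨L', hg⟩ := hg
  obtain ⟨C, hC⟩ := isCompact_univ.exists_bound_of_continuousOn hf.continuous.continuousOn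
  obtain ⟨C', hC'⟩ := isCompact_univ.exists_bound_of_continuousOn hg.continuous.continuousOn
  refine ⟨C.toNNReal * L' + L * C'.toNNReal, LipschitzWith.of_dist_le_mul fun x y => ?_⟩
  have h1 := hf.dist_le_mul x y
  have h2 := hg.dist_le_mul x y
  rw [Real.dist_eq] at *
  calc |f x * g x - f y * g y| = |f x * (g x - g y) + (f x - f y) * g y| := by ring_nf
    _ ≤ |f x| * |g x - g y| + |f x - f y| * |g y| := by
        refine (abs_add_le _ _).trans ?_
        rw [abs_mul, abs_mul]
    _ ≤ C.toNNReal * (L' * dist x y) + L * dist x y * C'.toNNReal := by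
        gcongr
        · exact (hC x trivial).trans (Real.le_coe_toNNReal C)
        · exact (hC' y trivial).trans (Real.le_coe_toNNReal C')
    _ = _ := by push_cast; ring

lemma exists_lipschitzWith_advect (hv : LipschitzWith K v) {χ : Torus d → ℝ} (hχ : Smooth χ) :
    ∃ L : ℝ≥0, LipschitzWith L (advect v χ) := by
  have h : ∀ i, ∃ L : ℝ≥0, LipschitzWith L (fun x => v x i * partialDeriv i χ x) := fun i =>
    exists_lipschitzWith_mul ⟨1 * K, (LipschitzWith.eval i).comp hv⟩
      (hχ.partialDeriv i).exists_lipschitzWith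
  unfold advect
  induction (Finset.univ : Finset (Fin d)) using Finset.induction_on with
  | empty => exact ⟨0, by simp⟩
  | insert i s hi ih =>
    obtain ⟨L, hL⟩ := ih
    obtain ⟨L', hL'⟩ := h i
    refine ⟨L' + L, ?_⟩
    simpa only [Finset.sum_insert hi] using hL'.add hL

lemma hasDerivAt_comp_flow (hv : LipschitzWith K v) {χ : Torus d → ℝ} (hχ : Smooth χ)
    (x : Torus d) (t : ℝ) :
    HasDerivAt (fun s => χ (flow v s x)) (advect v χ (flow v t x)) t := by
  obtain ⟨X, hX, h⟩ := exists_orbit_over hv x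
  simp only [h]
  rw [advect_proj hχ]
  exact (hχ.differentiable (by simp) (X t)).hasFDerivAt.comp_hasDerivAt t (hX t)

lemma exists_taylor_flow (hv : LipschitzWith K v) {χ : Torus d → ℝ} (hχ : Smooth χ) :
    ∃ C : ℝ, 0 ≤ C ∧ ∀ x h, |χ (flow v h x) - χ x - h * advect v χ x| ≤ C * h ^ 2 := by
  obtain ⟨M, hM⟩ := exists_norm_le hv
  obtain ⟨L, hL⟩ := exists_lipschitzWith_advect hv hχ
  refine ⟨L * M, by positivity, fun x h => ?_⟩
  have := norm_sub_le_sq (C := L * M) (hasDerivAt_comp_flow hv hχ x) (fun t => by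
    have h1 := hL.dist_le_mul (flow v t x) (flow v 0 x)
    have h2 := dist_flow_flow_le hv hM t 0 x
    rw [dist_eq_norm] at h1
    refine h1.trans ?_
    rw [mul_assoc]
    gcongr
    simpa using h2) (by positivity) h
  simpa [flow_zero hv] using this

/-! ### Mollification on the torus -/

/-- The mean of `f` against a normalized bump function. -/
def bumpMean (ρ : ContDiffBump (0 : Fin d → ℝ)) (f : (Fin d → ℝ) → ℝ) : ℝ :=
  ∫ y, ρ.normed volume y * f y

lemma integrable_bump_mul (ρ : ContDiffBump (0 : Fin d → ℝ)) {f : (Fin d → ℝ) → ℝ}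
    (hf : Continuous f) : Integrable (fun y => ρ.normed volume y * f y) :=
  (ρ.continuous_normed.mul hf).integrable_of_hasCompactSupport
    ρ.hasCompactSupport_normed.mul_right

lemma bumpMean_sub (ρ : ContDiffBump (0 : Fin d → ℝ)) {f g : (Fin d → ℝ) → ℝ}
    (hf : Continuous f) (hg : Continuous g) :
    bumpMean ρ (fun y => f y - g y) = bumpMean ρ f - bumpMean ρ g := by
  simp only [bumpMean, mul_sub]
  exact integral_sub (integrable_bump_mul ρ hf) (integrable_bump_mul ρ hg)

lemma bumpMean_const_mul (ρ : ContDiffBump (0 : Fin d → ℝ)) (c : ℝ) (f : (Fin d → ℝ) → ℝ) :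
    bumpMean ρ (fun y => c * f y) = c * bumpMean ρ f := by
  simp only [bumpMean, mul_left_comm _ c]
  exact integral_const_mul _ _

lemma bumpMean_const (ρ : ContDiffBump (0 : Fin d → ℝ)) (c : ℝ) :
    bumpMean ρ (fun _ => c) = c := by
  simp only [bumpMean]
  rw [integral_mul_const, ρ.integral_normed, one_mul]

lemma abs_bumpMean_le (ρ : ContDiffBump (0 : Fin d → ℝ)) {f : (Fin d → ℝ) → ℝ} {δ : ℝ}
    (h : ∀ y, ‖y‖ ≤ ρ.rOut → |f y| ≤ δ) : |bumpMean ρ f| ≤ δ := by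
  have h1 : ∀ y, ‖ρ.normed volume y * f y‖ ≤ ρ.normed volume y * δ := fun y => by
    rw [norm_mul, Real.norm_of_nonneg (ρ.nonneg_normed y), Real.norm_eq_abs]
    by_cases hy : ‖y‖ ≤ ρ.rOut
    · exact mul_le_mul_of_nonneg_left (h y hy) (ρ.nonneg_normed y)
    · have : ρ.normed volume y = 0 := by
        rw [← Function.notMem_support, ρ.support_normed_eq, mem_ball_zero_iff]
        exact fun h' => hy h'.le
      simp [this]
  calc |bumpMean ρ f| ≤ ∫ y, ρ.normed volume y * δ :=
        norm_integral_le_of_norm_le (ρ.integrable_normed.mul_const δ) (ae_of_all _ h1)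
    _ = δ := bumpMean_const ρ δ

/-- Mollification of a function on the torus. -/
def mollify (ρ : ContDiffBump (0 : Fin d → ℝ)) (w : Torus d → ℝ) (x : Torus d) : ℝ :=
  bumpMean ρ (fun y => w (x - proj y))

lemma continuous_sub_proj {w : Torus d → ℝ} (hw : Continuous w) (x : Torus d) :
    Continuous (fun y => w (x - proj y)) :=
  hw.comp (continuous_const.sub continuous_proj)

lemma smooth_mollify (ρ : ContDiffBump (0 : Fin d → ℝ)) {w : Torus d → ℝ} (hw : Continuous w) :
    Smooth (mollify ρ w) := by
  have h : ContDiff ℝ ∞ (MeasureTheory.convolution (ρ.normed volume)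
      (fun y : Fin d → ℝ => w (proj y)) (ContinuousLinearMap.mul ℝ ℝ) volume) :=
    ρ.hasCompactSupport_normed.contDiff_convolution_left _ ρ.contDiff_normed
      (hw.comp continuous_proj).locallyIntegrable
  unfold Smooth
  convert h using 2 with y
  simp only [mollify, bumpMean, convolution_mul, proj_sub]

lemma abs_mollify_sub_le (ρ : ContDiffBump (0 : Fin d → ℝ)) {w : Torus d → ℝ}
    (hw : Continuous w) {δ : ℝ} (h : ∀ x z, dist x z ≤ ρ.rOut → |w x - w z| ≤ δ) (x : Torus d) :
    |mollify ρ w x - w x| ≤ δ := by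
  rw [← bumpMean_const ρ (w x), mollify, ← bumpMean_sub ρ (continuous_sub_proj hw x)
    continuous_const]
  refine abs_bumpMean_le ρ fun y hy => h _ _ ?_
  rw [dist_eq_norm, sub_sub_cancel_left, norm_neg]
  exact (norm_proj_le y).trans hy

lemma exists_bump {ε : ℝ} (hε : 0 < ε) : ∃ ρ : ContDiffBump (0 : Fin d → ℝ), ρ.rOut = ε :=
  ⟨⟨ε / 2, ε, by positivity, by linarith⟩, rfl⟩

lemma exists_smooth_near {w : Torus d → ℝ} (hw : Continuous w) {ε : ℝ} (hε : 0 < ε) :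
    ∃ χ, Smooth χ ∧ ∀ x, |χ x - w x| ≤ ε := by
  obtain ⟨δ, hδ, h⟩ := Metric.uniformContinuous_iff.1
    (CompactSpace.uniformContinuous_of_continuous hw) ε hε
  obtain ⟨ρ, hρ⟩ := exists_bump (d := d) (half_pos hδ)
  refine ⟨mollify ρ w, smooth_mollify ρ hw, abs_mollify_sub_le ρ hw fun x z hxz => ?_⟩
  exact (h (hxz.trans_lt (by linarith))).le

/-- `w` is a Lipschitz function whose derivative along the flow of `v` is the Lipschitz function
`u`, with a uniform second order remainder. -/
structure HasFlowDeriv (v : Torus d → Fin d → ℝ) (w u : Torus d → ℝ) : Prop where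
  lipschitz : ∃ L : ℝ≥0, LipschitzWith L w
  lipschitz_deriv : ∃ L : ℝ≥0, LipschitzWith L u
  taylor : ∃ C : ℝ, 0 ≤ C ∧ ∀ x h, |w (flow v h x) - w x - h * u x| ≤ C * h ^ 2

lemma hasDerivAt_line {χ : Torus d → ℝ} (hχ : Smooth χ) (x : Torus d) :
    HasDerivAt (fun h : ℝ => χ (x + proj (h • v x))) (advect v χ x) 0 := by
  obtain ⟨y, rfl⟩ := proj_surjective x
  rw [advect_proj hχ]
  have hd : HasFDerivAt (fun z : Fin d → ℝ => χ (proj z)) _ (y + (0 : ℝ) • v (proj y)) :=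
    (hχ.differentiable (by simp) _).hasFDerivAt
  have h1 : HasDerivAt (fun s : ℝ => y + s • v (proj y)) (v (proj y)) 0 := by
    simpa using ((hasDerivAt_id (0 : ℝ)).smul_const (v (proj y))).const_add y
  have h2 := hd.comp_hasDerivAt (0 : ℝ) h1
  rw [zero_smul, add_zero] at h2
  simpa only [← proj_add] using! h2

/-- A commutator estimate. Moving the mollified function from `x` by `h • v x` moves each `w z`,
with `z` near `x`, by the same vector. Replacing `v x` by `v z` costs `h * K * ρ.rOut`, and
replacing the straight step by the flow costs `O(h²)`. Hence only the derivative of `w` along the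
flow is needed. -/
lemma abs_advect_mollify_sub_le (hv : LipschitzWith K v) (ρ : ContDiffBump (0 : Fin d → ℝ))
    {w u : Torus d → ℝ} {L L' : ℝ≥0} (hw : LipschitzWith L w) (hu : LipschitzWith L' u)
    {C : ℝ} (ht : ∀ x h, |w (flow v h x) - w x - h * u x| ≤ C * h ^ 2)
    (x : Torus d) : |advect v (mollify ρ w) x - u x| ≤ (L * K + L') * ρ.rOut := by
  obtain ⟨M, hM⟩ := exists_norm_le hv
  have hr := ρ.rOut_pos
  have h1 : |mollify ρ u x - u x| ≤ L' * ρ.rOut :=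
    abs_mollify_sub_le ρ hu.continuous (fun x z hxz => (hu.dist_le_mul x z).trans (by gcongr)) x
  have h2 : ∀ h : ℝ, 0 < h → |mollify ρ w (x + proj (h • v x)) - mollify ρ w x
      - h * mollify ρ u x| ≤ (L * K * ρ.rOut + (L * K * M + C) * h) * h := by
    intro h hh
    have c1 := continuous_sub_proj hw.continuous (x + proj (h • v x))
    have c2 := continuous_sub_proj hw.continuous x
    have c3 := continuous_sub_proj hu.continuous x
    rw [mollify, mollify, mollify, ← bumpMean_const_mul, ← bumpMean_sub ρ c1 c2,
      ← bumpMean_sub ρ (by exact c1.sub c2) (by exact c3.const_mul h)]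
    refine abs_bumpMean_le ρ fun y hy => ?_
    set z := x - proj y with hz
    have e : x + proj (h • v x) - proj y = z + proj (h • v x) := by rw [hz]; abel
    rw [e]
    have a1 : dist (z + proj (h • v x)) (flow v h z) ≤ h * (K * ρ.rOut) + K * M * h ^ 2 := by
      refine (dist_triangle _ (z + proj (h • v z)) _).trans (add_le_add ?_ ?_)
      · rw [dist_add_left]
        have b1 := lipschitzWith_proj.dist_le_mul (h • v x) (h • v z)
        have b2 := hv.dist_le_mul x z
        have b3 : dist x z ≤ ρ.rOut := by
          rw [hz, dist_eq_norm, sub_sub_cancel]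
          exact (norm_proj_le y).trans hy
        rw [dist_smul₀, Real.norm_of_nonneg hh.le, NNReal.coe_one, one_mul] at b1
        refine b1.trans (mul_le_mul_of_nonneg_left (b2.trans ?_) hh.le)
        gcongr
      · rw [dist_comm]
        exact dist_flow_add_le hv hM h z
    have a2 := hw.dist_le_mul (z + proj (h • v x)) (flow v h z)
    have a3 := ht z h
    rw [Real.dist_eq] at a2
    have a4 : (L : ℝ) * dist (z + proj (h • v x)) (flow v h z)
        ≤ L * (h * (K * ρ.rOut) + K * M * h ^ 2) := by gcongr
    calc |w (z + proj (h • v x)) - w z - h * u z|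
        = |(w (z + proj (h • v x)) - w (flow v h z)) + (w (flow v h z) - w z - h * u z)| := by
          ring_nf
      _ ≤ _ := abs_add_le _ _
      _ ≤ L * (h * (K * ρ.rOut) + K * M * h ^ 2) + C * h ^ 2 := by linarith
      _ = _ := by ring
  have h3 := (hasDerivAt_line (v := v) (smooth_mollify ρ hw.continuous) x).tendsto_slope_zero_right
  -- Dividing `h2` by `h` and letting `h ↓ 0` leaves only the term proportional to the mollification
  -- radius.
  have h4 : |advect v (mollify ρ w) x - mollify ρ u x| ≤ L * K * ρ.rOut + (L * K * M + C) * 0 := by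
    have t1 : Tendsto (fun h : ℝ => L * K * ρ.rOut + (L * K * M + C) * h) (𝓝[>] 0)
        (𝓝 (L * K * ρ.rOut + (L * K * M + C) * 0)) :=
      ((continuous_const.add (continuous_const.mul continuous_id)).tendsto 0).mono_left
        nhdsWithin_le_nhds
    refine le_of_tendsto_of_tendsto (h3.sub_const (mollify ρ u x)).abs t1 ?_
    filter_upwards [self_mem_nhdsWithin] with h hh
    have hh' : (0 : ℝ) < h := hh
    have := h2 h hh'
    simp only [zero_add, zero_smul, proj_zero, add_zero, smul_eq_mul]
    rw [← mul_le_mul_iff_left₀ hh']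
    refine le_trans (le_of_eq ?_) this
    rw [← abs_of_pos hh', ← abs_mul, abs_of_pos hh']
    congr 1
    field_simp
  calc |advect v (mollify ρ w) x - u x|
      = |(advect v (mollify ρ w) x - mollify ρ u x) + (mollify ρ u x - u x)| := by ring_nf
    _ ≤ _ := abs_add_le _ _
    _ ≤ _ := by linarith

lemma HasFlowDeriv.exists_smooth_near (hv : LipschitzWith K v) {w u : Torus d → ℝ}
    (hwu : HasFlowDeriv v w u) {ε : ℝ} (hε : 0 < ε) :
    ∃ χ, Smooth χ ∧ ∀ x, |χ x - w x| ≤ ε ∧ |advect v χ x - u x| ≤ ε := by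
  obtain ⟨L, hw⟩ := hwu.lipschitz
  obtain ⟨L', hu⟩ := hwu.lipschitz_deriv
  obtain ⟨C, -, ht⟩ := hwu.taylor
  -- This constant dominates both error rates, `L` for the values and `L * K + L'` for the
  -- derivatives; the `1` keeps it positive.
  have hA : (0 : ℝ) < L * K + L' + L + 1 := by positivity
  obtain ⟨ρ, hρ⟩ := exists_bump (d := d) (div_pos hε hA)
  have hr : (L * K + L' + L + 1) * ρ.rOut = ε := by rw [hρ]; field_simp
  have hp := ρ.rOut_pos
  refine ⟨mollify ρ w, smooth_mollify ρ hw.continuous, fun x => ⟨?_, ?_⟩⟩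
  · refine (abs_mollify_sub_le ρ hw.continuous (δ := L * ρ.rOut)
      (fun x z hxz => (hw.dist_le_mul x z).trans (by gcongr)) x).trans ?_
    rw [← hr]
    refine mul_le_mul_of_nonneg_right ?_ hp.le
    linarith [mul_nonneg L.coe_nonneg K.coe_nonneg, L'.coe_nonneg]
  · refine (abs_advect_mollify_sub_le hv ρ hw hu ht x).trans ?_
    rw [← hr]
    refine mul_le_mul_of_nonneg_right ?_ hp.le
    linarith [L.coe_nonneg]

lemma flow_comm (hv : LipschitzWith K v) (t s : ℝ) (x : Torus d) :
    flow v t (flow v s x) = flow v s (flow v t x) := by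
  rw [← flow_add hv, ← flow_add hv, add_comm]

/-- The flow commutes with itself, so differentiating along it never differentiates `ψ_{-s}`, which
is only Lipschitz. -/
lemma hasFlowDeriv_comp_flow (hv : LipschitzWith K v) {χ : Torus d → ℝ} (hχ : Smooth χ) (s : ℝ) :
    HasFlowDeriv v (fun x => χ (flow v (-s) x)) (fun x => advect v χ (flow v (-s) x)) where
  lipschitz := by
    obtain ⟨L, hL⟩ := hχ.exists_lipschitzWith
    exact ⟨_, hL.comp (lipschitzWith_flow hv (-s))⟩
  lipschitz_deriv := by
    obtain ⟨L, hL⟩ := exists_lipschitzWith_advect hv hχ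
    exact ⟨_, hL.comp (lipschitzWith_flow hv (-s))⟩
  taylor := by
    obtain ⟨C, hC, h⟩ := exists_taylor_flow hv hχ
    refine ⟨C, hC, fun x t => ?_⟩
    rw [flow_comm hv]
    exact h _ t

/-! ### Weak solutions tested against functions that are only Lipschitz -/

lemma abs_integral_mul_sub_le {α : Type*} [MeasurableSpace α] {μ : Measure α} {f g h : α → ℝ}
    {ε : ℝ} (hf : Integrable f μ) (hfg : Integrable (fun x => f x * g x) μ)
    (hfh : Integrable (fun x => f x * h x) μ) (hgh : ∀ᵐ x ∂μ, |g x - h x| ≤ ε) :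
    |(∫ x, f x * g x ∂μ) - ∫ x, f x * h x ∂μ| ≤ ε * ∫ x, |f x| ∂μ := by
  rw [← integral_sub hfg hfh, ← integral_const_mul, ← Real.norm_eq_abs]
  refine norm_integral_le_of_norm_le (hf.abs.const_mul ε) ?_
  filter_upwards [hgh] with x hx
  rw [← mul_sub, norm_mul, mul_comm, Real.norm_eq_abs, Real.norm_eq_abs]
  gcongr

lemma exists_abs_le {X : Type*} [TopologicalSpace X] [CompactSpace X] {g : X → ℝ}
    (hg : Continuous g) : ∃ C : ℝ, ∀ x, |g x| ≤ C := by
  obtain ⟨C, hC⟩ := isCompact_univ.exists_bound_of_continuousOn hg.continuousOn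
  exact ⟨C, fun x => hC x trivial⟩

lemma integrable_mul_of_continuous {f g : Torus d → ℝ} (hf : Integrable f) (hg : Continuous g) :
    Integrable (fun x => f x * g x) := by
  obtain ⟨C, hC⟩ := exists_abs_le hg
  exact hf.mul_bdd (c := C) hg.aestronglyMeasurable (ae_of_all _ hC)

/-- Lebesgue measure on the time-space slab `(a, b] × 𝕋ᵈ`. -/
abbrev slab (d : ℕ) (a b : ℝ) : Measure (ℝ × Torus d) :=
  (volume.restrict (Set.Ioc a b)).prod volume

lemma integrable_slab_mono {f : ℝ × Torus d → ℝ} {a b T : ℝ} (ha : 0 ≤ a) (hb : b ≤ T)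
    (hf : Integrable f (slab d 0 T)) : Integrable f (slab d a b) :=
  hf.mono_measure (Measure.prod_mono (Measure.restrict_mono (Set.Ioc_subset_Ioc ha hb) le_rfl)
    le_rfl)

lemma integrable_slab_mul {f : ℝ × Torus d → ℝ} {g : ℝ × Torus d → ℝ} {a b : ℝ}
    (hf : Integrable f (slab d a b)) (hg : Continuous g) :
    Integrable (fun z => f z * g z) (slab d a b) := by
  obtain ⟨C, hC⟩ := (isCompact_Icc (a := a) (b := b)).prod (isCompact_univ (X := Torus d))
    |>.exists_bound_of_continuousOn hg.continuousOn
  refine hf.mul_bdd (c := C) hg.aestronglyMeasurable ?_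
  have : ∀ᵐ z : ℝ × Torus d ∂(slab d a b), z ∈ Set.Ioc a b ×ˢ Set.univ := by
    rw [slab, ← Measure.restrict_univ (μ := (volume : Measure (Torus d))), Measure.prod_restrict]
    exact ae_restrict_mem (measurableSet_Ioc.prod MeasurableSet.univ)
  filter_upwards [this] with z hz
  exact hC z ⟨Set.Ioc_subset_Icc_self hz.1, trivial⟩

lemma integral_slab {f : ℝ × Torus d → ℝ} {a b : ℝ} (hab : a ≤ b)
    (hf : Integrable f (slab d a b)) :
    ∫ s in a..b, ∫ x, f (s, x) = ∫ z, f z ∂(slab d a b) := by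
  rw [intervalIntegral.integral_of_le hab, integral_prod _ hf]

lemma integral_slab_add {f : ℝ × Torus d → ℝ} {a b c : ℝ} (hab : a ≤ b) (hbc : b ≤ c)
    (hf : Integrable f (slab d a c)) :
    ∫ z, f z ∂(slab d a c) = (∫ z, f z ∂(slab d a b)) + ∫ z, f z ∂(slab d b c) := by
  have e : slab d a c = slab d a b + slab d b c := by
    rw [slab, ← Set.Ioc_union_Ioc_eq_Ioc hab hbc, Measure.restrict_union
      (Set.Ioc_disjoint_Ioc_of_le le_rfl) measurableSet_Ioc, Measure.add_prod]
  rw [e] at hf ⊢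
  exact integral_add_measure hf.left_of_add_measure hf.right_of_add_measure

namespace IsWeakSolution

variable {φ θ₀ : Torus d → ℝ} {θ : ℝ → Torus d → ℝ}

lemma integrable_slab (hθ : IsWeakSolution v φ θ₀ θ) {a b : ℝ} (ha : 0 ≤ a) :
    Integrable (fun z : ℝ × Torus d => θ z.1 z.2) (slab d a b) :=
  integrable_slab_mono ha (le_max_left b 1) (hθ.integrable (max b 1) (by positivity))

lemma integrable_damping_slab (hθ : IsWeakSolution v φ θ₀ θ) {a b : ℝ} (ha : 0 ≤ a) :
    Integrable (fun z : ℝ × Torus d => φ z.2 * θ z.1 z.2) (slab d a b) :=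
  integrable_slab_mono ha (le_max_left b 1) (hθ.integrable_damping (max b 1) (by positivity))

lemma eq_slab (hv : LipschitzWith K v) (hθ : IsWeakSolution v φ θ₀ θ) {χ : Torus d → ℝ}
    (hχ : Smooth χ) {t : ℝ} (ht : 0 ≤ t) :
    ∫ x, θ t x * χ x = (∫ x, θ₀ x * χ x) + ((∫ z, θ z.1 z.2 * advect v χ z.2 ∂(slab d 0 t))
      - ∫ z, φ z.2 * θ z.1 z.2 * χ z.2 ∂(slab d 0 t)) := by
  obtain ⟨L, hL⟩ := exists_lipschitzWith_advect hv hχ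
  have i1 := integrable_slab_mul (hθ.integrable_slab (b := t) le_rfl)
    (hL.continuous.comp continuous_snd)
  have i2 := integrable_slab_mul (hθ.integrable_damping_slab (b := t) le_rfl)
    (hχ.continuous.comp continuous_snd)
  rw [hθ.weak_eq χ hχ t ht]
  have := integral_slab ht (i1.sub i2)
  simp only [Pi.sub_apply, Function.comp_apply] at this i1 i2
  rw [this, integral_sub i1 i2]

/-- The weak formulation holds for Lipschitz functions with a Lipschitz derivative along the
flow. -/
lemma eq_of_hasFlowDeriv (hv : LipschitzWith K v) (h₀ : Integrable θ₀)
    (hθ : IsWeakSolution v φ θ₀ θ) {w u : Torus d → ℝ} (hwu : HasFlowDeriv v w u) {t : ℝ}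
    (ht : 0 ≤ t) :
    ∫ x, θ t x * w x = (∫ x, θ₀ x * w x) + ((∫ z, θ z.1 z.2 * u z.2 ∂(slab d 0 t))
      - ∫ z, φ z.2 * θ z.1 z.2 * w z.2 ∂(slab d 0 t)) := by
  have hw : Continuous w := hwu.lipschitz.choose_spec.continuous
  have hu : Continuous u := hwu.lipschitz_deriv.choose_spec.continuous
  have it := hθ.integrable_slice t ht
  have is := hθ.integrable_slab (b := t) le_rfl
  have id := hθ.integrable_damping_slab (b := t) le_rfl
  set B : ℝ := (∫ x, |θ t x|) + (∫ x, |θ₀ x|) + (∫ z, |θ z.1 z.2| ∂(slab d 0 t))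
    + ∫ z, |φ z.2 * θ z.1 z.2| ∂(slab d 0 t) with hB
  have hB0 : 0 ≤ B := by positivity
  refine eq_of_forall_dist_le fun ε hε => ?_
  -- `B` collects the four `L¹` masses against which the test function or its derivative is
  -- integrated, so the total error is at most `ε`.
  obtain ⟨χ, hχ, hn⟩ := hwu.exists_smooth_near hv (ε := ε / (B + 1)) (by positivity)
  obtain ⟨L, hL⟩ := exists_lipschitzWith_advect hv hχ
  have e := hθ.eq_slab hv hχ ht
  have c1 := abs_le.1 <| abs_integral_mul_sub_le it (integrable_mul_of_continuous it hχ.continuous)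
    (integrable_mul_of_continuous it hw) (ae_of_all _ fun x => (hn x).1)
  have c2 := abs_le.1 <| abs_integral_mul_sub_le h₀ (integrable_mul_of_continuous h₀ hχ.continuous)
    (integrable_mul_of_continuous h₀ hw) (ae_of_all _ fun x => (hn x).1)
  have c3 := abs_le.1 <| abs_integral_mul_sub_le is
    (integrable_slab_mul is (hL.continuous.comp continuous_snd))
    (integrable_slab_mul is (hu.comp continuous_snd)) (ae_of_all _ fun z => (hn z.2).2)
  have c4 := abs_le.1 <| abs_integral_mul_sub_le id
    (integrable_slab_mul id (hχ.continuous.comp continuous_snd))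
    (integrable_slab_mul id (hw.comp continuous_snd)) (ae_of_all _ fun z => (hn z.2).1)
  simp only [Function.comp_apply] at c3 c4
  have hle : ε / (B + 1) * B ≤ ε := by
    rw [div_mul_eq_mul_div, div_le_iff₀ (by positivity)]
    nlinarith
  rw [hB] at hle
  simp only [mul_add] at hle
  rw [Real.dist_eq, abs_le]
  constructor <;> linarith [c1.1, c1.2, c2.1, c2.2, c3.1, c3.2, c4.1, c4.2]

end IsWeakSolution

/-! ### Test functions carried by the flow -/

/-- The function `t ↦ χ (ψ_{-t} x)` has derivative `-(v · ∇χ) (ψ_{-t} x)`, and both are Lipschitz in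
`t` uniformly in `x`. -/
lemma exists_transport_bound (hv : LipschitzWith K v) {χ : Torus d → ℝ} (hχ : Smooth χ) :
    ∃ C : ℝ, 0 ≤ C ∧ ∀ a b x,
      |χ (flow v (-b) x) - χ (flow v (-a) x)| ≤ C * |b - a| ∧
      |advect v χ (flow v (-b) x) - advect v χ (flow v (-a) x)| ≤ C * |b - a| ∧
      |χ (flow v (-b) x) - χ (flow v (-a) x) + (b - a) * advect v χ (flow v (-a) x)|
        ≤ C * (b - a) ^ 2 := by
  obtain ⟨M, hM⟩ := exists_norm_le hv
  obtain ⟨L, hL⟩ := hχ.exists_lipschitzWith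
  obtain ⟨L', hL'⟩ := exists_lipschitzWith_advect hv hχ
  obtain ⟨C, hC, ht⟩ := exists_taylor_flow hv hχ
  have hd : ∀ a b x, dist (flow v (-b) x) (flow v (-a) x) ≤ M * |b - a| := fun a b x => by
    refine (dist_flow_flow_le hv hM (-b) (-a) x).trans_eq ?_
    rw [abs_sub_comm]
    ring_nf
  refine ⟨L * M + L' * M + C, by positivity, fun a b x => ⟨?_, ?_, ?_⟩⟩
  · calc |χ (flow v (-b) x) - χ (flow v (-a) x)|
        ≤ L * dist (flow v (-b) x) (flow v (-a) x) := hL.dist_le_mul _ _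
      _ ≤ L * (M * |b - a|) := by gcongr; exact hd a b x
      _ ≤ (L * M + L' * M + C) * |b - a| := by
        have : 0 ≤ (L' * M + C) * |b - a| := by positivity
        linarith
  · calc |advect v χ (flow v (-b) x) - advect v χ (flow v (-a) x)|
        ≤ L' * dist (flow v (-b) x) (flow v (-a) x) := hL'.dist_le_mul _ _
      _ ≤ L' * (M * |b - a|) := by gcongr; exact hd a b x
      _ ≤ (L * M + L' * M + C) * |b - a| := by
        have : 0 ≤ (L * M + C) * |b - a| := by positivity
        linarith
  · have h := ht (flow v (-a) x) (-(b - a))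
    rw [← flow_add hv, show -(b - a) + -a = -b by ring] at h
    calc |χ (flow v (-b) x) - χ (flow v (-a) x) + (b - a) * advect v χ (flow v (-a) x)|
        = |χ (flow v (-b) x) - χ (flow v (-a) x) - -(b - a) * advect v χ (flow v (-a) x)| := by
          ring_nf
      _ ≤ C * (-(b - a)) ^ 2 := h
      _ ≤ (L * M + L' * M + C) * (b - a) ^ 2 := by
        have : 0 ≤ (L * M + L' * M) * (b - a) ^ 2 := by positivity
        linarith

lemma continuous_comp_flow_neg (hv : LipschitzWith K v) {f : Torus d → ℝ} (hf : Continuous f) :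
    Continuous (fun z : ℝ × Torus d => f (flow v (-z.1) z.2)) :=
  hf.comp ((continuous_flow_uncurry hv).comp (by fun_prop : Continuous
    (fun z : ℝ × Torus d => (-z.1, z.2))))

/-- Over `n + 1` equal steps the increments of `m` telescope, while the step length provides a
factor `T / (n + 1)` that tends to zero. No continuity of `m` is needed. -/
lemma eq_of_abs_sub_le_mul_sub {Φ m : ℝ → ℝ} {C : ℝ}
    (h : ∀ a b, 0 ≤ a → a ≤ b → |Φ b - Φ a| ≤ C * (b - a) * (m b - m a)) {T : ℝ} (hT : 0 ≤ T) :
    Φ T = Φ 0 := by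
  have key : ∀ n : ℕ, |Φ T - Φ 0| ≤ C * T * (m T - m 0) * (1 / ((n : ℝ) + 1)) := by
    intro n
    set δ : ℝ := T / (n + 1) with hδ
    have hδ0 : 0 ≤ δ := by positivity
    have hs : ∀ k : ℕ, |Φ (k * δ) - Φ 0| ≤ C * δ * (m (k * δ) - m 0) := by
      intro k
      induction k with
      | zero => simp
      | succ k ih =>
        have := h (k * δ) ((k + 1 : ℕ) * δ) (by positivity) (by push_cast; linarith)
        rw [show ((k + 1 : ℕ) : ℝ) * δ - k * δ = δ by push_cast; ring] at this
        have t := abs_sub_le (Φ ((k + 1 : ℕ) * δ)) (Φ (k * δ)) (Φ 0)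
        linarith
    have := hs (n + 1)
    have e : ((n + 1 : ℕ) : ℝ) * δ = T := by push_cast; rw [hδ]; field_simp
    rw [e] at this
    refine this.trans_eq ?_
    rw [hδ]
    ring
  have lim : Tendsto (fun n : ℕ => C * T * (m T - m 0) * (1 / ((n : ℝ) + 1))) atTop (𝓝 0) := by
    simpa using tendsto_one_div_add_atTop_nhds_zero_nat.const_mul (C * T * (m T - m 0))
  have := ge_of_tendsto' lim key
  exact sub_eq_zero.1 (abs_nonpos_iff.1 this)

namespace IsWeakSolution

variable {φ θ₀ : Torus d → ℝ} {θ : ℝ → Torus d → ℝ}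

lemma sub_eq_slab (hv : LipschitzWith K v) (h₀ : Integrable θ₀)
    (hθ : IsWeakSolution v φ θ₀ θ) {w u : Torus d → ℝ} (hwu : HasFlowDeriv v w u) {a b : ℝ}
    (ha : 0 ≤ a) (hab : a ≤ b) :
    (∫ x, θ b x * w x) - ∫ x, θ a x * w x = (∫ z, θ z.1 z.2 * u z.2 ∂(slab d a b))
      - ∫ z, φ z.2 * θ z.1 z.2 * w z.2 ∂(slab d a b) := by
  have hw : Continuous w := hwu.lipschitz.choose_spec.continuous
  have hu : Continuous u := hwu.lipschitz_deriv.choose_spec.continuous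
  have e1 := integral_slab_add ha hab
    (integrable_slab_mul (hθ.integrable_slab (b := b) le_rfl) (hu.comp continuous_snd))
  have e2 := integral_slab_add ha hab
    (integrable_slab_mul (hθ.integrable_damping_slab (b := b) le_rfl) (hw.comp continuous_snd))
  simp only [Function.comp_apply] at e1 e2
  rw [hθ.eq_of_hasFlowDeriv hv h₀ hwu ha, hθ.eq_of_hasFlowDeriv hv h₀ hwu (ha.trans hab), e1, e2]
  ring

/-- The increment over a short time interval of a solution tested against a function carried
by the flow is the damping term up to a quadratic error. -/
lemma abs_increment_le (hv : LipschitzWith K v) (h₀ : Integrable θ₀)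
    (hθ : IsWeakSolution v φ θ₀ θ) {χ : Torus d → ℝ} (hχ : Smooth χ) :
    ∃ C : ℝ, ∀ a b, 0 ≤ a → a ≤ b →
      |(∫ x, θ b x * χ (flow v (-b) x)) - (∫ x, θ a x * χ (flow v (-a) x))
        + ∫ z, φ z.2 * θ z.1 z.2 * χ (flow v (-z.1) z.2) ∂(slab d a b)|
      ≤ C * (b - a) * ∫ z, (|θ z.1 z.2| + |φ z.2 * θ z.1 z.2|) ∂(slab d a b) := by
  obtain ⟨C, hC, hb⟩ := exists_transport_bound hv hχ
  obtain ⟨L', hL'⟩ := exists_lipschitzWith_advect hv hχ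
  refine ⟨3 * C, fun a b ha hab => ?_⟩
  rcases hab.eq_or_lt with rfl | hlt
  · simp [slab]
  set Δ := b - a with hΔ
  have hΔ0 : 0 < Δ := sub_pos.2 hlt
  set N := ∫ z, (|θ z.1 z.2| + |φ z.2 * θ z.1 z.2|) ∂(slab d a b) with hN
  have is := hθ.integrable_slab (b := b) ha
  have id := hθ.integrable_damping_slab (b := b) ha
  have hN' : N = (∫ z, |θ z.1 z.2| ∂(slab d a b)) + ∫ z, |φ z.2 * θ z.1 z.2| ∂(slab d a b) :=
    integral_add is.abs id.abs
  have hN0 : (0 : ℝ) ≤ ∫ z, |θ z.1 z.2| ∂(slab d a b) := by positivity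
  have hN1 : (0 : ℝ) ≤ ∫ z, |φ z.2 * θ z.1 z.2| ∂(slab d a b) := by positivity
  set w : ℝ → Torus d → ℝ := fun s x => χ (flow v (-s) x) with hw
  set u : ℝ → Torus d → ℝ := fun s x => advect v χ (flow v (-s) x) with hu
  have cw : ∀ s, Continuous (w s) := fun s => hχ.continuous.comp (continuous_flow hv _)
  have cu : ∀ s, Continuous (u s) := fun s => hL'.continuous.comp (continuous_flow hv _)
  have hwu : ∀ s, HasFlowDeriv v (w s) (u s) := hasFlowDeriv_comp_flow hv hχ
  -- replacing the damping at time `r` by the damping at time `a`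
  have s1 : |(∫ z, φ z.2 * θ z.1 z.2 * w z.1 z.2 ∂(slab d a b))
      - ∫ z, φ z.2 * θ z.1 z.2 * w a z.2 ∂(slab d a b)| ≤ C * Δ * N := by
    have := abs_integral_mul_sub_le id
      (integrable_slab_mul id (continuous_comp_flow_neg hv hχ.continuous))
      (integrable_slab_mul id ((cw a).comp continuous_snd)) (ε := C * Δ) (by
        have hm : ∀ᵐ z : ℝ × Torus d ∂(slab d a b), z.1 ∈ Set.Ioc a b :=
          Measure.quasiMeasurePreserving_fst.ae (ae_restrict_mem measurableSet_Ioc)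
        filter_upwards [hm] with z hz
        refine (hb a z.1 z.2).1.trans ?_
        gcongr
        rw [abs_of_pos (sub_pos.2 hz.1)]
        linarith [hz.2])
    refine this.trans ?_
    gcongr
    linarith
  -- the pairing of `θ t` with the increment of the test function
  set q : ℝ → ℝ := fun t => ∫ x, θ t x * (w b x - w a x) with hq
  have q_eq : ∀ t, 0 ≤ t → q t = (∫ x, θ t x * w b x) - ∫ x, θ t x * w a x := fun t ht => by
    have it := hθ.integrable_slice t ht
    rw [← integral_sub (integrable_mul_of_continuous it (cw b))
      (integrable_mul_of_continuous it (cw a))]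
    simp only [hq, mul_sub]
  -- On `(t, b]` the equations tested with `w b` and `w a` are subtracted; these functions and their
  -- flow derivatives differ by at most `C * Δ`.
  have s2 : ∀ t, a ≤ t → t ≤ b → |q b - q t| ≤ C * Δ * N := by
    intro t hat htb
    have ht := ha.trans hat
    have e1 := hθ.sub_eq_slab hv h₀ (hwu b) ht htb
    have e2 := hθ.sub_eq_slab hv h₀ (hwu a) ht htb
    have is' := hθ.integrable_slab (b := b) ht
    have id' := hθ.integrable_damping_slab (b := b) ht
    have b1 := abs_le.1 <| abs_integral_mul_sub_le is'
      (integrable_slab_mul is' ((cu b).comp continuous_snd))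
      (integrable_slab_mul is' ((cu a).comp continuous_snd)) (ε := C * Δ)
      (ae_of_all _ fun z => (hb a b z.2).2.1.trans_eq (by rw [abs_of_pos hΔ0]))
    have b2 := abs_le.1 <| abs_integral_mul_sub_le id'
      (integrable_slab_mul id' ((cw b).comp continuous_snd))
      (integrable_slab_mul id' ((cw a).comp continuous_snd)) (ε := C * Δ)
      (ae_of_all _ fun z => (hb a b z.2).1.trans_eq (by rw [abs_of_pos hΔ0]))
    have hmono : (∫ z, (|θ z.1 z.2| + |φ z.2 * θ z.1 z.2|) ∂(slab d t b)) ≤ N := by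
      have e := integral_slab_add hat htb (is.abs.add id.abs)
      simp only [Pi.add_apply] at e
      rw [hN, e]
      have : 0 ≤ ∫ z, (|θ z.1 z.2| + |φ z.2 * θ z.1 z.2|) ∂(slab d a t) := by positivity
      linarith
    have hsum : (∫ z, (|θ z.1 z.2| + |φ z.2 * θ z.1 z.2|) ∂(slab d t b))
        = (∫ z, |θ z.1 z.2| ∂(slab d t b)) + ∫ z, |φ z.2 * θ z.1 z.2| ∂(slab d t b) :=
      integral_add is'.abs id'.abs
    have hm := mul_le_mul_of_nonneg_left hmono (by positivity : 0 ≤ C * Δ)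
    rw [hsum, mul_add] at hm
    simp only [Function.comp_apply] at b1 b2
    rw [q_eq b (ht.trans htb), q_eq t ht, abs_le]
    constructor <;> linarith [b1.1, b1.2, b2.1, b2.2]
  -- Taylor expansion of the test function at time `a`, with `θ t` held fixed: `w b - w a` is close
  -- to `-Δ * u a`.
  have s3 : ∀ t, 0 ≤ t → |q t + Δ * ∫ x, θ t x * u a x| ≤ C * Δ ^ 2 * ∫ x, |θ t x| := by
    intro t ht
    have it := hθ.integrable_slice t ht
    have := abs_integral_mul_sub_le it
      (integrable_mul_of_continuous it ((cw b).sub (cw a)))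
      (integrable_mul_of_continuous it ((cu a).const_mul (-Δ))) (ε := C * Δ ^ 2)
      (ae_of_all _ fun x => by
        refine (le_of_eq ?_).trans (hb a b x).2.2
        simp only [hw, hu, Pi.sub_apply, neg_mul, sub_neg_eq_add, ← hΔ])
    refine (le_of_eq ?_).trans this
    rw [← integral_const_mul, hq]
    simp only [Pi.sub_apply]
    rw [sub_eq_add_neg, ← integral_neg]
    congr 3
    funext x
    ring
  have iu : Integrable (fun z : ℝ × Torus d => θ z.1 z.2 * u a z.2) (slab d a b) :=
    integrable_slab_mul is ((cu a).comp continuous_snd)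
  -- The single slice norm `∫ |θ t|` has no bound uniform in `t`. Averaging over `t ∈ (a, b]`
  -- replaces it by the slab mass, which is additive in time.
  have s4 : |q b + ∫ z, θ z.1 z.2 * u a z.2 ∂(slab d a b)| ≤ 2 * (C * Δ * N) := by
    have i1 : Integrable (fun t => ∫ x, θ t x * u a x) (volume.restrict (Set.Ioc a b)) :=
      iu.integral_prod_left
    have i2 : Integrable (fun t => ∫ x, |θ t x|) (volume.restrict (Set.Ioc a b)) :=
      is.abs.integral_prod_left
    have e1 : ∫ z, θ z.1 z.2 * u a z.2 ∂(slab d a b) = ∫ t in Set.Ioc a b, ∫ x, θ t x * u a x :=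
      integral_prod _ iu
    have e2 : ∫ z, |θ z.1 z.2| ∂(slab d a b) = ∫ t in Set.Ioc a b, ∫ x, |θ t x| :=
      integral_prod _ is.abs
    have e3 : ∫ _ in Set.Ioc a b, q b = Δ * q b := by
      simp [hΔ, hlt.le]
    have b1 : ‖∫ t in Set.Ioc a b, (q b + Δ * ∫ x, θ t x * u a x)‖
        ≤ ∫ t in Set.Ioc a b, (C * Δ * N + C * Δ ^ 2 * ∫ x, |θ t x|) := by
      refine norm_integral_le_of_norm_le ((integrable_const _).add (i2.const_mul _)) ?_
      filter_upwards [ae_restrict_mem measurableSet_Ioc] with t ht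
      have ht0 := ha.trans ht.1.le
      have c1 := s2 t ht.1.le ht.2
      have c2 := s3 t ht0
      calc ‖q b + Δ * ∫ x, θ t x * u a x‖
          = |(q b - q t) + (q t + Δ * ∫ x, θ t x * u a x)| := by
            rw [Real.norm_eq_abs]; ring_nf
        _ ≤ _ := abs_add_le _ _
        _ ≤ _ := add_le_add c1 c2
    rw [integral_add (integrable_const _) (i1.const_mul _),
      integral_add (integrable_const _) (i2.const_mul _), integral_const_mul Δ,
      integral_const_mul (C * Δ ^ 2), ← e1, ← e2, e3, ← mul_add, norm_mul, Real.norm_of_nonneg hΔ0.le, Real.norm_eq_abs] at b1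
    have e4 : ∫ _ in Set.Ioc a b, C * Δ * N = Δ * (C * Δ * N) := by
      simp [hΔ, hlt.le]
    rw [e4, show C * Δ ^ 2 * ∫ z, |θ z.1 z.2| ∂(slab d a b)
      = Δ * (C * Δ * ∫ z, |θ z.1 z.2| ∂(slab d a b)) by ring, ← mul_add] at b1
    have b2 := le_of_mul_le_mul_left b1 hΔ0
    have : C * Δ * ∫ z, |θ z.1 z.2| ∂(slab d a b) ≤ C * Δ * N := by
      gcongr
      linarith
    linarith
  -- The increment is `q b` plus the increment tested against the frozen `w a`. By `s4` the
  -- advection term cancels `q b` up to `2 * C * Δ * N`; by `s1` freezing the damping costs `C * Δ *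
  -- N`, whence `3 * C`.
  have e5 := hθ.sub_eq_slab hv h₀ (hwu a) ha hab
  have e6 := q_eq b (ha.trans hab)
  have s1' := abs_le.1 s1
  have s4' := abs_le.1 s4
  rw [abs_le]
  constructor <;> linarith [s1'.1, s1'.2, s4'.1, s4'.2]

/-- A weak solution tested against functions carried by the flow. -/
lemma eq_flow (hv : LipschitzWith K v) (h₀ : Integrable θ₀)
    (hθ : IsWeakSolution v φ θ₀ θ) {χ : Torus d → ℝ} (hχ : Smooth χ) {T : ℝ} (hT : 0 ≤ T) :
    ∫ x, θ T x * χ (flow v (-T) x) = (∫ x, θ₀ x * χ x)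
      - ∫ z, φ z.2 * θ z.1 z.2 * χ (flow v (-z.1) z.2) ∂(slab d 0 T) := by
  obtain ⟨C, hC⟩ := hθ.abs_increment_le hv h₀ hχ
  have key := eq_of_abs_sub_le_mul_sub (C := C)
    (Φ := fun t => (∫ x, θ t x * χ (flow v (-t) x))
      + ∫ z, φ z.2 * θ z.1 z.2 * χ (flow v (-z.1) z.2) ∂(slab d 0 t))
    (m := fun t => ∫ z, (|θ z.1 z.2| + |φ z.2 * θ z.1 z.2|) ∂(slab d 0 t))
    (fun a b ha hab => by
      have id := hθ.integrable_damping_slab (b := b) le_rfl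
      have e1 := integral_slab_add ha hab
        (integrable_slab_mul id (continuous_comp_flow_neg hv hχ.continuous))
      have e2 := integral_slab_add ha hab ((hθ.integrable_slab (b := b) le_rfl).abs.add id.abs)
      simp only [Pi.add_apply] at e2
      simp only [e1, e2]
      convert hC a b ha hab using 2 <;> ring) hT
  have e0 := hθ.weak_eq χ hχ 0 le_rfl
  simp only [neg_zero, flow_zero hv, intervalIntegral.integral_same, add_zero] at key e0
  simp only [slab, Set.Ioc_self, Measure.restrict_empty, Measure.zero_prod,
    integral_zero_measure, add_zero] at key
  rw [e0] at key
  exact eq_sub_of_add_eq key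

end IsWeakSolution

/-! ### The flow of a divergence-free field preserves the volume -/

instance : IsProbabilityMeasure (volume : Measure UnitAddCircle) :=
  ⟨UnitAddCircle.measure_univ⟩

lemma DivergenceFree.isWeakSolution_one (hdiv : DivergenceFree v) :
    IsWeakSolution v (fun _ => 0) (fun _ => 1) (fun _ _ => 1) where
  integrable_slice _ _ := integrable_const _
  integrable _ _ := integrable_const _
  integrable_damping _ _ := by simp
  weak_eq χ hχ t _ := by simp [hdiv χ hχ]

/-- The constant `1` solves the undamped equation because the field is divergence free, so `eq_flow`
applies with no damping term. -/
lemma integral_comp_flow_neg (hv : LipschitzWith K v) (hdiv : DivergenceFree v)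
    {χ : Torus d → ℝ} (hχ : Smooth χ) {T : ℝ} (hT : 0 ≤ T) :
    ∫ x, χ (flow v (-T) x) = ∫ x, χ x := by
  simpa using hdiv.isWeakSolution_one.eq_flow hv (integrable_const _) hχ hT

/-- Smooth functions are uniformly dense among continuous ones, which determine a finite measure. -/
lemma integral_eq_of_smooth {m : Measure (Torus d)} {m' : Measure (Torus d)} [IsFiniteMeasure m]
    [IsFiniteMeasure m'] (h : ∀ χ : Torus d → ℝ, Smooth χ → ∫ x, χ x ∂m = ∫ x, χ x ∂m') :
    m = m' := by
  refine ext_of_forall_integral_eq_of_IsFiniteMeasure fun f => ?_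
  refine eq_of_forall_dist_le fun ε hε => ?_
  set B := m.real Set.univ + m'.real Set.univ + 1 with hB
  have hB0 : 0 < B := by positivity
  obtain ⟨χ, hχ, hn⟩ := exists_smooth_near f.continuous (div_pos hε hB0)
  have key : ∀ (μ : Measure (Torus d)) [IsFiniteMeasure μ],
      |(∫ x, χ x ∂μ) - ∫ x, f x ∂μ| ≤ ε / B * μ.real Set.univ := fun μ _ => by
    have ic : ∀ g : Torus d → ℝ, Continuous g → Integrable g μ := fun g hg => by
      obtain ⟨C, hC⟩ := exists_abs_le hg
      exact Integrable.of_bound hg.aestronglyMeasurable C (ae_of_all _ hC)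
    have := abs_integral_mul_sub_le (integrable_const (1 : ℝ) (μ := μ))
      (by simpa using ic χ hχ.continuous) (by simpa using ic f f.continuous) (ae_of_all _ hn)
    simpa using this
  have k1 := abs_le.1 (key m)
  have k2 := abs_le.1 (key m')
  have hle : ε / B * m.real Set.univ + ε / B * m'.real Set.univ ≤ ε := by
    rw [← mul_add, div_mul_eq_mul_div, div_le_iff₀ hB0]
    gcongr
    linarith
  rw [Real.dist_eq, abs_le]
  have := h χ hχ
  constructor <;> linarith [k1.1, k1.2, k2.1, k2.2]

lemma measurePreserving_flow (hv : LipschitzWith K v) (hdiv : DivergenceFree v) (t : ℝ) :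
    MeasurePreserving (flow v t) (volume : Measure (Torus d)) volume := by
  have hneg : ∀ T : ℝ, 0 ≤ T →
      MeasurePreserving (flow v (-T)) (volume : Measure (Torus d)) volume := fun T hT => by
    refine ⟨(continuous_flow hv _).measurable, ?_⟩
    have : IsProbabilityMeasure (Measure.map (flow v (-T)) (volume : Measure (Torus d))) :=
      Measure.isProbabilityMeasure_map (continuous_flow hv _).aemeasurable
    refine integral_eq_of_smooth fun χ hχ => ?_
    rw [integral_map (continuous_flow hv _).aemeasurable hχ.continuous.aestronglyMeasurable]
    exact integral_comp_flow_neg hv hdiv hχ hT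
  rcases le_total t 0 with ht | ht
  · simpa using hneg (-t) (by linarith)
  -- Forward times follow because `ψ_t` inverts the map `ψ_{-t}`, already known to preserve the
  -- volume.
  · refine ⟨(continuous_flow hv _).measurable, ?_⟩
    conv_lhs => rw [← (hneg t ht).map_eq]
    rw [Measure.map_map (continuous_flow hv _).measurable (continuous_flow hv _).measurable]
    have : flow v t ∘ flow v (-t) = id := funext fun x => flow_flow_neg hv t x
    rw [this, Measure.map_id]

/-! ### Auxiliary facts of measure theory -/

lemma integral_comp_measurePreserving {α β : Type*} [MeasurableSpace α] [MeasurableSpace β]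
    {μ : Measure α} {ν : Measure β} {S : α → β} (hS : MeasurePreserving S μ ν) {f : β → ℝ}
    (hf : AEStronglyMeasurable f ν) : ∫ x, f (S x) ∂μ = ∫ y, f y ∂ν := by
  rw [← hS.map_eq] at hf ⊢
  exact (integral_map hS.measurable.aemeasurable hf).symm

/-- Slicewise null sets give a null set of the product only under measurability; hence the passage
to measurable representatives. -/
lemma ae_eq_prod_of_ae_ae {α β : Type*} [MeasurableSpace α] [MeasurableSpace β]
    {μ : Measure α} {ν : Measure β} [SFinite ν] {f g : α × β → ℝ}
    (hf : AEStronglyMeasurable f (μ.prod ν)) (hg : AEStronglyMeasurable g (μ.prod ν))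
    (h : ∀ᵐ x ∂μ, ∀ᵐ y ∂ν, f (x, y) = g (x, y)) : f =ᵐ[μ.prod ν] g := by
  have hmk : ∀ᵐ z ∂(μ.prod ν), hf.mk f z = hg.mk g z := by
    rw [Measure.ae_prod_iff_ae_ae
      (measurableSet_eq_fun hf.stronglyMeasurable_mk.measurable
        hg.stronglyMeasurable_mk.measurable)]
    filter_upwards [h, Measure.ae_ae_of_ae_prod hf.ae_eq_mk, Measure.ae_ae_of_ae_prod hg.ae_eq_mk]
      with x h1 h2 h3
    filter_upwards [h1, h2, h3] with y k1 k2 k3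
    rw [← k2, ← k3, k1]
  filter_upwards [hmk, hf.ae_eq_mk, hg.ae_eq_mk] with z k1 k2 k3
  rw [k2, k3, k1]

/-- The positive and negative parts of `h` are densities of two finite measures with equal integrals
of smooth functions, so they agree a.e.; as one of them vanishes at each point, so does `h`. -/
lemma ae_eq_zero_of_integral_smooth {h : Torus d → ℝ} (hh : Integrable h)
    (h0 : ∀ χ : Torus d → ℝ, Smooth χ → ∫ x, h x * χ x = 0) : ∀ᵐ x, h x = 0 := by
  have key : ∀ f : Torus d → ℝ, Integrable f → ∀ χ : Torus d → ℝ, ∫ x, χ x ∂(volume.withDensity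
      fun x => ENNReal.ofReal (f x)) = ∫ x, max (f x) 0 * χ x := fun f hf χ => by
    rw [integral_withDensity_eq_integral_toReal_smul₀ hf.aemeasurable.ennreal_ofReal
      (ae_of_all _ fun _ => ENNReal.ofReal_lt_top)]
    simp only [ENNReal.toReal_ofReal', smul_eq_mul]
  have hfin : ∀ f : Torus d → ℝ, Integrable f → ∫⁻ x, ENNReal.ofReal (f x) ≠ ⊤ := fun f hf =>
    (hf.lintegral_lt_top).ne
  have f1 : IsFiniteMeasure (volume.withDensity fun x => ENNReal.ofReal (h x)) :=
    isFiniteMeasure_withDensity (hfin h hh)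
  have f2 : IsFiniteMeasure (volume.withDensity fun x => ENNReal.ofReal (-h x)) :=
    isFiniteMeasure_withDensity (hfin _ hh.neg)
  have e : (volume.withDensity fun x => ENNReal.ofReal (h x))
      = volume.withDensity fun x => ENNReal.ofReal (-h x) := by
    refine integral_eq_of_smooth fun χ hχ => ?_
    rw [key h hh, key (fun x => -h x) hh.neg, ← sub_eq_zero, ← integral_sub
      (integrable_mul_of_continuous hh.pos_part hχ.continuous)
      (by exact integrable_mul_of_continuous hh.neg.pos_part hχ.continuous)]
    refine Eq.trans ?_ (h0 χ hχ)
    congr 1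
    funext x
    rw [← sub_mul]
    congr 1
    exact max_zero_sub_max_neg_zero_eq_self (h x)
  have e' := (withDensity_eq_iff hh.aemeasurable.ennreal_ofReal
    hh.neg.aemeasurable.ennreal_ofReal (hfin h hh)).1 e
  filter_upwards [e'] with x hx
  rw [Pi.neg_apply] at hx
  rcases le_total (h x) 0 with h' | h'
  · rw [ENNReal.ofReal_of_nonpos h', eq_comm, ENNReal.ofReal_eq_zero] at hx
    linarith
  · rw [ENNReal.ofReal_of_nonpos (by linarith : -h x ≤ 0), ENNReal.ofReal_eq_zero] at hx
    linarith

/-! ### Linear scalar equations with an integrable coefficient -/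

/-- A function absolutely continuous on the interval is bounded there by some `C`, and `exp` is
Lipschitz with constant `exp C` on `(-∞, C]`. -/
lemma absolutelyContinuousOnInterval_exp {f : ℝ → ℝ} {a b : ℝ}
    (hf : AbsolutelyContinuousOnInterval f a b) :
    AbsolutelyContinuousOnInterval (fun x => Real.exp (f x)) a b := by
  obtain ⟨C, hC⟩ := hf.exists_bound
  have hL : ∀ x ∈ Set.uIcc a b, ∀ y ∈ Set.uIcc a b,
      dist (Real.exp (f x)) (Real.exp (f y)) ≤ Real.exp C * dist (f x) (f y) := by
    intro x hx y hy
    have hm : ∀ z ∈ Set.uIcc a b, f z ∈ Set.Iic C := fun z hz => (le_abs_self _).trans (hC z hz)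
    rw [dist_eq_norm, dist_eq_norm]
    exact Convex.norm_image_sub_le_of_norm_hasDerivWithin_le (f := Real.exp) (f' := Real.exp)
      (s := Set.Iic C) (fun z _ => (Real.hasDerivAt_exp z).hasDerivWithinAt)
      (fun z hz => by rw [Real.norm_of_nonneg (Real.exp_pos _).le]; exact Real.exp_le_exp.2 hz)
      (convex_Iic C) (hm y hy) (hm x hx)
  rw [absolutelyContinuousOnInterval_iff] at hf ⊢
  intro ε hε
  obtain ⟨δ, hδ, h⟩ := hf (ε / Real.exp C) (by positivity)
  refine ⟨δ, hδ, fun E hE hlt => ?_⟩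
  have h1 := h E hE hlt
  rw [lt_div_iff₀ (Real.exp_pos C), mul_comm, Finset.mul_sum] at h1
  refine lt_of_le_of_lt (Finset.sum_le_sum fun i hi => ?_) h1
  exact hL _ (hE.1 i hi).1 _ (hE.1 i hi).2

/-- The product of `c - ∫ a g` with the integrating factor `exp (∫ a)` is absolutely continuous with
derivative zero a.e., hence constant. Since `g` satisfies the equation only a.e., the conclusion
concerns its continuous version. -/
lemma linear_integral_equation {a g : ℝ → ℝ} {c T : ℝ} (hT : 0 ≤ T)
    (ha : IntervalIntegrable a volume 0 T) (hag : IntervalIntegrable (fun t => a t * g t) volume 0 T)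
    (hg : ∀ᵐ t ∂(volume.restrict (Set.Ioc 0 T)), g t = c - ∫ s in (0 : ℝ)..t, a s * g s) :
    c - ∫ s in (0 : ℝ)..T, a s * g s = c * Real.exp (-∫ s in (0 : ℝ)..T, a s) := by
  set y : ℝ → ℝ := fun t => c - ∫ s in (0 : ℝ)..t, a s * g s with hy
  set E : ℝ → ℝ := fun t => Real.exp (∫ s in (0 : ℝ)..t, a s) with hE
  have yAC : AbsolutelyContinuousOnInterval y 0 T := by
    have h1 := hag.absolutelyContinuousOnInterval_intervalIntegral Set.left_mem_uIcc
    have h2 : AbsolutelyContinuousOnInterval (fun _ : ℝ => c) 0 T :=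
      (LipschitzWith.const c).lipschitzOnWith.absolutelyContinuousOnInterval
    exact h2.sub h1
  have EAC : AbsolutelyContinuousOnInterval E 0 T := absolutelyContinuousOnInterval_exp
    (ha.absolutelyContinuousOnInterval_intervalIntegral Set.left_mem_uIcc)
  have hne : ∀ᵐ t : ℝ, t ≠ 0 := by simp [ae_iff]
  obtain ⟨C, hC⟩ := (yAC.mul EAC).const_of_ae_hasDerivAt_zero (by
    rw [ae_restrict_iff' measurableSet_Ioc] at hg
    filter_upwards [hg, ha.ae_hasDerivAt_integral, hag.ae_hasDerivAt_integral, hne]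
      with t h1 h2 h3 h4 ht
    have d1 := h2 ht 0 Set.left_mem_uIcc
    have d2 := h3 ht 0 Set.left_mem_uIcc
    rw [Set.uIcc_of_le hT] at ht
    have h5 := h1 ⟨lt_of_le_of_ne ht.1 h4.symm, ht.2⟩
    have d3 := (d2.const_sub c).mul d1.exp
    convert! d3 using 1
    rw [h5]
    ring)
  have e0 := hC 0 Set.left_mem_uIcc
  have eT := hC T Set.right_mem_uIcc
  rw [← e0] at eT
  simp only [Pi.mul_apply, hy, hE, intervalIntegral.integral_same, sub_zero, Real.exp_zero,
    mul_one] at eT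
  conv_rhs => rw [← eT]
  rw [mul_assoc, ← Real.exp_add, add_neg_cancel, Real.exp_zero, mul_one]

/-! ### Weak solutions along the flow -/

lemma measurePreserving_skew (hv : LipschitzWith K v) (hdiv : DivergenceFree v) (a b : ℝ) :
    MeasurePreserving (fun z : ℝ × Torus d => (z.1, flow v z.1 z.2)) (slab d a b) (slab d a b) :=
  (MeasurePreserving.id _).skew_product (g := flow v) (continuous_flow_uncurry hv).measurable
    (ae_of_all _ fun t => (measurePreserving_flow hv hdiv t).map_eq)

lemma integrable_slab_snd {φ : Torus d → ℝ} (hφ : Integrable φ) (a b : ℝ) :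
    Integrable (fun z : ℝ × Torus d => φ z.2) (slab d a b) :=
  hφ.comp_snd _

lemma ae_intervalIntegrable_comp_flow (hv : LipschitzWith K v) (hdiv : DivergenceFree v)
    {φ : Torus d → ℝ} (hφ : Integrable φ) {T : ℝ} (hT : 0 ≤ T) :
    ∀ᵐ x, IntervalIntegrable (fun t => φ (flow v t x)) volume 0 T := by
  have h := ((measurePreserving_skew hv hdiv 0 T).integrable_comp_of_integrable
    (integrable_slab_snd hφ 0 T)).prod_left_ae
  filter_upwards [h] with x hx
  rw [intervalIntegrable_iff_integrableOn_Ioc_of_le hT]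
  exact hx

/-- The variable endpoint becomes an indicator: the primitive is the integral over `s ∈ (0, T]` of
`f (s, x)` restricted to `s ≤ t`, to which measurability of parametric integrals applies. -/
lemma aestronglyMeasurable_primitive {f : ℝ × Torus d → ℝ} {T : ℝ}
    (hf : Integrable f (slab d 0 T)) :
    AEStronglyMeasurable (fun z : ℝ × Torus d => ∫ s in (0 : ℝ)..z.1, f (s, z.2))
      (slab d 0 T) := by
  have hq : Measure.QuasiMeasurePreserving (fun p : (ℝ × Torus d) × ℝ => (p.2, p.1.2))
      ((slab d 0 T).prod (volume.restrict (Set.Ioc 0 T))) (slab d 0 T) := by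
    have h1 : Measure.QuasiMeasurePreserving (Prod.map Prod.snd id)
        ((slab d 0 T).prod (volume.restrict (Set.Ioc 0 T)))
        ((volume : Measure (Torus d)).prod (volume.restrict (Set.Ioc 0 T))) :=
      MeasureTheory.QuasiMeasurePreserving.prodMap Measure.quasiMeasurePreserving_snd
        (Measure.QuasiMeasurePreserving.id _)
    exact Measure.measurePreserving_swap.quasiMeasurePreserving.comp h1
  have h2 : AEStronglyMeasurable (Set.indicator {p : (ℝ × Torus d) × ℝ | p.2 ≤ p.1.1}
      (fun p => f (p.2, p.1.2))) ((slab d 0 T).prod (volume.restrict (Set.Ioc 0 T))) :=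
    (hf.aestronglyMeasurable.comp_quasiMeasurePreserving hq).indicator
      (measurableSet_le measurable_snd measurable_fst.fst)
  refine h2.integral_prod_right'.congr ?_
  have hm : ∀ᵐ z : ℝ × Torus d ∂(slab d 0 T), z.1 ∈ Set.Ioc 0 T :=
    Measure.quasiMeasurePreserving_fst.ae (ae_restrict_mem measurableSet_Ioc)
  filter_upwards [hm] with z hz
  rw [intervalIntegral.integral_of_le hz.1.le, ← integral_indicator measurableSet_Ioc,
    ← integral_indicator measurableSet_Ioc]
  congr 1
  funext s
  simp only [Set.indicator_apply, Set.mem_ofPred_eq, Set.mem_Ioc]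
  have := hz.2
  grind

namespace IsWeakSolution

variable {φ θ₀ : Torus d → ℝ} {θ : ℝ → Torus d → ℝ}

lemma integrable_damping_flow (hv : LipschitzWith K v) (hdiv : DivergenceFree v)
    (hθ : IsWeakSolution v φ θ₀ θ) (T : ℝ) :
    Integrable (fun z : ℝ × Torus d => φ (flow v z.1 z.2) * θ z.1 (flow v z.1 z.2))
      (slab d 0 T) :=
  (measurePreserving_skew hv hdiv 0 T).integrable_comp_of_integrable
    (hθ.integrable_damping_slab le_rfl)

/-- Along the flow, a weak solution satisfies the integrated equation almost everywhere. -/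
lemma ae_eq_integral (hv : LipschitzWith K v) (hdiv : DivergenceFree v) (h₀ : Integrable θ₀)
    (hθ : IsWeakSolution v φ θ₀ θ) {T : ℝ} (hT : 0 ≤ T) :
    ∀ᵐ x, θ T (flow v T x)
      = θ₀ x - ∫ s in (0 : ℝ)..T, φ (flow v s x) * θ s (flow v s x) := by
  have hf := hθ.integrable_damping_flow hv hdiv T
  have iT : Integrable (fun x => θ T (flow v T x)) :=
    (measurePreserving_flow hv hdiv T).integrable_comp_of_integrable (hθ.integrable_slice T hT)
  have iI : Integrable (fun x => ∫ s in (0 : ℝ)..T, φ (flow v s x) * θ s (flow v s x)) := by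
    simp only [intervalIntegral.integral_of_le hT]
    exact hf.integral_prod_right
  have key := ae_eq_zero_of_integral_smooth ((iT.sub h₀).add iI) fun χ hχ => by
    have e1 := hθ.eq_flow hv h₀ hχ hT
    have m1 : AEStronglyMeasurable (fun x => θ T x * χ (flow v (-T) x)) volume :=
      (hθ.integrable_slice T hT).aestronglyMeasurable.mul
        (hχ.continuous.comp (continuous_flow hv _)).aestronglyMeasurable
    have i2 := integrable_slab_mul (hθ.integrable_damping_slab (b := T) le_rfl)
      (continuous_comp_flow_neg hv hχ.continuous)
    -- The substitutions `x ↦ ψ_T x` and `(s, x) ↦ (s, ψ_s x)` free `χ` of the flow, leaving an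
    -- identity against arbitrary smooth `χ`.
    rw [← integral_comp_measurePreserving (measurePreserving_flow hv hdiv T) m1,
      ← integral_comp_measurePreserving (measurePreserving_skew hv hdiv 0 T)
        i2.aestronglyMeasurable] at e1
    simp only [flow_neg_flow hv] at e1
    have i3 : Integrable (fun z : ℝ × Torus d =>
        φ (flow v z.1 z.2) * θ z.1 (flow v z.1 z.2) * χ z.2) (slab d 0 T) :=
      integrable_slab_mul hf (hχ.continuous.comp continuous_snd)
    rw [integral_prod_symm _ i3] at e1
    simp only [← intervalIntegral.integral_of_le hT] at e1
    have j1 := integrable_mul_of_continuous iT hχ.continuous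
    have j2 := integrable_mul_of_continuous h₀ hχ.continuous
    have j3 := integrable_mul_of_continuous iI hχ.continuous
    simp only [Pi.add_apply, Pi.sub_apply, add_mul, sub_mul]
    simp only [intervalIntegral.integral_mul_const] at e1
    rw [integral_add (by exact j1.sub j2) j3, integral_sub j1 j2, e1]
    ring
  filter_upwards [key] with x hx
  simp only [Pi.add_apply, Pi.sub_apply] at hx
  linarith

/-- The representation of weak solutions along the flow. -/
theorem ae_eq_exp (hv : LipschitzWith K v) (hdiv : DivergenceFree v) (hφ : Integrable φ)
    (h₀ : Integrable θ₀) (hθ : IsWeakSolution v φ θ₀ θ) {T : ℝ} (hT : 0 ≤ T) :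
    ∀ᵐ x, θ T (flow v T x) = θ₀ x * Real.exp (-∫ s in (0 : ℝ)..T, φ (flow v s x)) := by
  have hf := hθ.integrable_damping_flow hv hdiv T
  have hg : Integrable (fun z : ℝ × Torus d => θ z.1 (flow v z.1 z.2)) (slab d 0 T) :=
    (measurePreserving_skew hv hdiv 0 T).integrable_comp_of_integrable
      (hθ.integrable_slab le_rfl)
  have hG : AEStronglyMeasurable (fun z : ℝ × Torus d => θ₀ z.2
      - ∫ s in (0 : ℝ)..z.1, φ (flow v s z.2) * θ s (flow v s z.2)) (slab d 0 T) :=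
    (integrable_slab_snd h₀ 0 T).aestronglyMeasurable.sub (aestronglyMeasurable_primitive hf)
  have h1 := ae_eq_prod_of_ae_ae hg.aestronglyMeasurable hG (by
    filter_upwards [ae_restrict_mem measurableSet_Ioc] with t ht
    exact hθ.ae_eq_integral hv hdiv h₀ ht.1.le)
  -- The exceptional set of points depends on `t`; Fubini gives instead, for a.e. `x`, the equation
  -- at a.e. `t`. The fixed time `T` is handled by a separate use of `ae_eq_integral`.
  have h2 : ∀ᵐ x : Torus d, ∀ᵐ t ∂(volume.restrict (Set.Ioc 0 T)), θ t (flow v t x)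
      = θ₀ x - ∫ s in (0 : ℝ)..t, φ (flow v s x) * θ s (flow v s x) :=
    Measure.ae_ae_of_ae_prod (Measure.measurePreserving_swap.quasiMeasurePreserving.ae h1)
  filter_upwards [h2, hf.prod_left_ae, ae_intervalIntegrable_comp_flow hv hdiv hφ hT,
    hθ.ae_eq_integral hv hdiv h₀ hT] with x k1 k2 k3 k4
  rw [k4]
  refine linear_integral_equation hT k3 ?_ k1
  rw [intervalIntegrable_iff_integrableOn_Ioc_of_le hT]
  exact k2

end IsWeakSolution

/-! ### The accumulated damping along orbits -/

/-- The map `(t, x) ↦ (t, ψ_t x)` preserves the product measure, so a null set of the torus is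
visited for almost no time by a.e. orbit. -/
lemma ae_ae_comp_flow (hv : LipschitzWith K v) (hdiv : DivergenceFree v) {P : Torus d → Prop}
    (hP : ∀ᵐ x, P x) : ∀ᵐ x, ∀ᵐ t : ℝ, P (flow v t x) := by
  have hS : MeasurePreserving (fun z : ℝ × Torus d => (z.1, flow v z.1 z.2))
      ((volume : Measure ℝ).prod volume) ((volume : Measure ℝ).prod volume) :=
    (MeasurePreserving.id _).skew_product (g := flow v) (continuous_flow_uncurry hv).measurable
      (ae_of_all _ fun t => (measurePreserving_flow hv hdiv t).map_eq)
  have h1 := hS.quasiMeasurePreserving.ae (Measure.quasiMeasurePreserving_snd.ae hP)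
  exact Measure.ae_ae_of_ae_prod (Measure.measurePreserving_swap.quasiMeasurePreserving.ae h1)

lemma ae_forall_intervalIntegrable_comp_flow (hv : LipschitzWith K v) (hdiv : DivergenceFree v)
    {φ : Torus d → ℝ} (hφ : Integrable φ) :
    ∀ᵐ x, ∀ T : ℝ, 0 ≤ T → IntervalIntegrable (fun t => φ (flow v t x)) volume 0 T := by
  have h := ae_all_iff.2 fun n : ℕ =>
    ae_intervalIntegrable_comp_flow hv hdiv hφ (T := n) (Nat.cast_nonneg n)
  filter_upwards [h] with x hx T hT
  obtain ⟨n, hn⟩ := exists_nat_ge T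
  refine (hx n).mono_set ?_
  rw [Set.uIcc_of_le hT, Set.uIcc_of_le (hT.trans hn)]
  exact Set.Icc_subset_Icc_right hn

lemma integral_mono_of_nonneg {f : ℝ → ℝ}
    (hf : ∀ T : ℝ, 0 ≤ T → IntervalIntegrable f volume 0 T) (h0 : ∀ᵐ t : ℝ, 0 ≤ f t) {s t : ℝ}
    (hs : 0 ≤ s) (hst : s ≤ t) : ∫ τ in (0 : ℝ)..s, f τ ≤ ∫ τ in (0 : ℝ)..t, f τ := by
  have h1 := hf s hs
  have h2 := hf t (hs.trans hst)
  rw [← intervalIntegral.integral_add_adjacent_intervals h1 (h1.symm.trans h2)]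
  have := intervalIntegral.integral_nonneg_of_ae hst h0
  linarith

lemma tendsto_atTop_or_bounded {f : ℝ → ℝ}
    (hf : ∀ T : ℝ, 0 ≤ T → IntervalIntegrable f volume 0 T) (h0 : ∀ᵐ t : ℝ, 0 ≤ f t) :
    Tendsto (fun t : ℝ => ∫ τ in (0 : ℝ)..t, f τ) atTop atTop ∨
      ∃ b : ℝ, ∀ t : ℝ, 0 ≤ t → ∫ τ in (0 : ℝ)..t, f τ ≤ b := by
  by_cases h : ∃ b : ℝ, ∀ t : ℝ, 0 ≤ t → ∫ τ in (0 : ℝ)..t, f τ ≤ b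
  · exact Or.inr h
  · left
    push Not at h
    refine tendsto_atTop.2 fun b => ?_
    obtain ⟨s, hs, hb⟩ := h b
    filter_upwards [eventually_ge_atTop s] with t ht
    exact hb.le.trans (integral_mono_of_nonneg hf h0 hs ht)

/-- The `Lᵖ` norm of a weak solution vanishes in the limit when the accumulated damping blows up
along almost every orbit. -/
lemma IsWeakSolution.tendsto_eLpNorm (hv : LipschitzWith K v) (hdiv : DivergenceFree v)
    {φ θ₀ : Torus d → ℝ} {θ : ℝ → Torus d → ℝ} (hφ : Integrable φ) (hφ0 : ∀ᵐ x, 0 ≤ φ x)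
    (hA : ∀ᵐ x, Tendsto (fun t : ℝ => ∫ τ in (0 : ℝ)..t, φ (flow v τ x)) atTop atTop)
    {p : ℝ≥0∞} (hp1 : 1 ≤ p) (hp : p ≠ ⊤) (h₀ : MemLp θ₀ p volume)
    (hθ : IsWeakSolution v φ θ₀ θ) :
    Tendsto (fun t : ℝ => eLpNorm (θ t) p volume) atTop (𝓝 0) := by
  have hp0 : p ≠ 0 := (zero_lt_one.trans_le hp1).ne'
  have hpr : 0 < p.toReal := ENNReal.toReal_pos hp0 hp
  have hi : Integrable θ₀ := h₀.integrable hp1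
  have hlim : Tendsto (fun t : ℝ => ∫⁻ x, ‖θ₀ x * Real.exp
      (-∫ τ in (0 : ℝ)..t, φ (flow v τ x))‖ₑ ^ p.toReal) atTop (𝓝 (∫⁻ _ : Torus d, 0)) := by
    -- The damping is nonnegative, so `|θ₀|ᵖ` dominates; its integrability requires `p ≠ ⊤`.
    refine tendsto_lintegral_filter_of_dominated_convergence' (fun x => ‖θ₀ x‖ₑ ^ p.toReal)
      ?_ ?_ ?_ ?_
    · filter_upwards [eventually_ge_atTop 0] with t ht
      have h1 : AEStronglyMeasurable (fun x => θ t (flow v t x)) volume :=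
        ((measurePreserving_flow hv hdiv t).integrable_comp_of_integrable
          (hθ.integrable_slice t ht)).aestronglyMeasurable
      exact (h1.congr (hθ.ae_eq_exp hv hdiv hφ hi ht)).enorm.pow_const _
    · filter_upwards [eventually_ge_atTop 0] with t ht
      filter_upwards [ae_ae_comp_flow hv hdiv hφ0] with x hx
      have h1 := intervalIntegral.integral_nonneg_of_ae ht hx
      gcongr
      rw [enorm_le_iff_norm_le, norm_mul]
      refine mul_le_of_le_one_right (norm_nonneg _) ?_
      rw [Real.norm_of_nonneg (Real.exp_pos _).le]
      exact Real.exp_le_one_iff.2 (by linarith)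
    · exact (lintegral_rpow_enorm_lt_top_of_eLpNorm_lt_top hp0 hp h₀.2).ne
    · filter_upwards [hA] with x hx
      have h1 : Tendsto (fun t : ℝ => θ₀ x * Real.exp (-∫ τ in (0 : ℝ)..t, φ (flow v τ x)))
          atTop (𝓝 (θ₀ x * 0)) :=
        (Real.tendsto_exp_atBot.comp (tendsto_neg_atTop_atBot.comp hx)).const_mul _
      have h2 := (ENNReal.continuous_rpow_const (y := p.toReal)).continuousAt.tendsto.comp h1.enorm
      simpa [ENNReal.zero_rpow_of_pos hpr] using! h2
  rw [lintegral_zero] at hlim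
  have h3 := (ENNReal.continuous_rpow_const (y := 1 / p.toReal)).continuousAt.tendsto.comp hlim
  rw [ENNReal.zero_rpow_of_pos (by positivity)] at h3
  refine h3.congr' ?_
  filter_upwards [eventually_ge_atTop 0] with t ht
  rw [← eLpNorm_comp_measurePreserving (hθ.integrable_slice t ht).aestronglyMeasurable
    (measurePreserving_flow hv hdiv t)]
  refine Eq.trans ?_ (eLpNorm_congr_ae (hθ.ae_eq_exp hv hdiv hφ hi ht)).symm
  rw [eLpNorm_eq_lintegral_rpow_enorm_toReal hp0 hp]
  rfl

/-- Where the Birkhoff limit is positive, the accumulated damping blows up. -/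
lemma ae_tendsto_of_birkhoffLimit_pos (hv : LipschitzWith K v) (hdiv : DivergenceFree v)
    {φ : Torus d → ℝ} (hφ : Integrable φ) (hφ0 : ∀ᵐ x, 0 ≤ φ x)
    (hpos : ∀ᵐ x, 0 < birkhoffLimit (flow v) φ x) :
    ∀ᵐ x, Tendsto (fun t : ℝ => ∫ τ in (0 : ℝ)..t, φ (flow v τ x)) atTop atTop := by
  filter_upwards [hpos, ae_ae_comp_flow hv hdiv hφ0,
    ae_forall_intervalIntegrable_comp_flow hv hdiv hφ] with x hx h0 hi
  refine (tendsto_atTop_or_bounded hi h0).resolve_right ?_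
  rintro ⟨b, hb⟩
  -- A bounded integral makes the averages converge to `0`, so `limUnder` is a genuine limit here
  -- and Birkhoff's theorem is not needed.
  have hlim : Tendsto (fun t : ℝ => (1 / t) * ∫ τ in (0 : ℝ)..t, φ (flow v τ x)) atTop (𝓝 0) := by
    have h1 : Tendsto (fun t : ℝ => (1 / t) * b) atTop (𝓝 0) := by
      simpa using (tendsto_inv_atTop_zero (𝕜 := ℝ)).mul_const b
    refine tendsto_of_tendsto_of_tendsto_of_le_of_le' tendsto_const_nhds h1 ?_ ?_
    · filter_upwards [eventually_ge_atTop 0] with t ht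
      exact mul_nonneg (by positivity) (intervalIntegral.integral_nonneg_of_ae ht h0)
    · filter_upwards [eventually_ge_atTop 0] with t ht
      exact mul_le_mul_of_nonneg_left (hb t ht) (by positivity)
  rw [birkhoffLimit, hlim.limUnder_eq] at hx
  exact hx.false

/-! ### Ergodic flows -/

lemma lintegral_Ioi_le_of_bounded {f : ℝ → ℝ}
    (hf : ∀ T : ℝ, 0 ≤ T → IntervalIntegrable f volume 0 T) (h0 : ∀ᵐ t : ℝ, 0 ≤ f t) {b : ℝ}
    (hb : ∀ t : ℝ, 0 ≤ t → ∫ τ in (0 : ℝ)..t, f τ ≤ b) :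
    ∫⁻ t in Set.Ioi (0 : ℝ), ENNReal.ofReal (f t) ≤ ENNReal.ofReal b := by
  have hU : Set.Ioi (0 : ℝ) = ⋃ n : ℕ, Set.Ioc (0 : ℝ) n := by
    ext t
    simp only [Set.mem_Ioi, Set.mem_iUnion, Set.mem_Ioc]
    exact ⟨fun h => (exists_nat_ge t).imp fun _ hn => ⟨h, hn⟩, fun ⟨_, h⟩ => h.1⟩
  rw [hU, setLIntegral_iUnion_of_directed _ (Monotone.directed_le fun m n hmn =>
    Set.Ioc_subset_Ioc_right (by exact_mod_cast hmn))]
  refine iSup_le fun n => ?_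
  have hn : (0 : ℝ) ≤ n := Nat.cast_nonneg n
  have hi := (intervalIntegrable_iff_integrableOn_Ioc_of_le hn).1 (hf n hn)
  rw [← ofReal_integral_eq_lintegral_ofReal hi (ae_restrict_of_ae h0),
    ← intervalIntegral.integral_of_le hn]
  exact ENNReal.ofReal_le_ofReal (hb n hn)

/-- The total mass of `g` along the forward orbit of `x`. -/
def forwardMass (v : Torus d → Fin d → ℝ) (g : Torus d → ℝ≥0∞) (x : Torus d) : ℝ≥0∞ :=
  ∫⁻ t in Set.Ioi (0 : ℝ), g (flow v t x)

lemma measurable_comp_flow (hv : LipschitzWith K v) {g : Torus d → ℝ≥0∞} (hg : Measurable g) :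
    Measurable (fun z : Torus d × ℝ => g (flow v z.2 z.1)) :=
  hg.comp ((continuous_flow_uncurry hv).measurable.comp measurable_swap)

lemma measurable_forwardMass (hv : LipschitzWith K v) {g : Torus d → ℝ≥0∞} (hg : Measurable g) :
    Measurable (forwardMass v g) :=
  (measurable_comp_flow hv hg).lintegral_prod_right'

/-- Moving the starting point forward only shortens the orbit; moving it back by `|t|` adds a
segment of that length, on which `g ≤ 1`. -/
lemma forwardMass_flow_le (hv : LipschitzWith K v) {g : Torus d → ℝ≥0∞} (hg1 : ∀ x, g x ≤ 1)
    (t : ℝ) (x : Torus d) :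
    forwardMass v g (flow v t x) ≤ ENNReal.ofReal (-t) + forwardMass v g x := by
  have hmp : MeasurePreserving (fun s : ℝ => s + t) (volume.restrict ((fun s => s + t) ⁻¹'
      Set.Ioi t)) (volume.restrict (Set.Ioi t)) :=
    (measurePreserving_add_right volume t).restrict_preimage measurableSet_Ioi
  have hpre : (fun s : ℝ => s + t) ⁻¹' Set.Ioi t = Set.Ioi 0 := by
    ext s; simp
  rw [hpre] at hmp
  have h1 : forwardMass v g (flow v t x) = ∫⁻ s in Set.Ioi t, g (flow v s x) := by
    rw [← hmp.lintegral_comp_emb (measurableEmbedding_addRight t)]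
    simp only [forwardMass, flow_add hv]
  have hsub : Set.Ioi t ⊆ Set.Ioc t 0 ∪ Set.Ioi 0 := fun s hs => by
    rcases le_or_gt s 0 with h | h
    · exact Or.inl ⟨hs, h⟩
    · exact Or.inr h
  calc forwardMass v g (flow v t x) = ∫⁻ s in Set.Ioi t, g (flow v s x) := h1
    _ ≤ ∫⁻ s in Set.Ioc t 0 ∪ Set.Ioi 0, g (flow v s x) := lintegral_mono_set hsub
    _ ≤ (∫⁻ s in Set.Ioc t 0, g (flow v s x)) + forwardMass v g x := lintegral_union_le _ _ _
    _ ≤ (∫⁻ _ in Set.Ioc t 0, 1) + forwardMass v g x := by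
        gcongr
        exact hg1 _
    _ = ENNReal.ofReal (-t) + forwardMass v g x := by simp

/-- `ErgodicFlow` asks for exact invariance at every time; the bound `g ≤ 1` provides it with no
exceptional null set. -/
lemma image_flow_forwardMass_lt_top (hv : LipschitzWith K v) {g : Torus d → ℝ≥0∞}
    (hg1 : ∀ x, g x ≤ 1) (t : ℝ) :
    flow v t '' {x | forwardMass v g x < ⊤} = {x | forwardMass v g x < ⊤} := by
  have h : ∀ s x, forwardMass v g x < ⊤ → forwardMass v g (flow v s x) < ⊤ := fun s x hx =>
    (forwardMass_flow_le hv hg1 s x).trans_lt (ENNReal.add_lt_top.2 ⟨ENNReal.ofReal_lt_top, hx⟩)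
  refine Set.Subset.antisymm ?_ fun x hx => ⟨flow v (-t) x, h _ _ hx, flow_flow_neg hv t x⟩
  rintro _ ⟨x, hx, rfl⟩
  exact h t x hx

/-- If the mass along almost every forward orbit is finite, the function vanishes. -/
lemma lintegral_eq_zero_of_forwardMass_lt_top (hv : LipschitzWith K v) (hdiv : DivergenceFree v)
    {g : Torus d → ℝ≥0∞} (hg : Measurable g) (hg1 : ∀ x, g x ≤ 1)
    (h : ∀ᵐ x, forwardMass v g x < ⊤) : ∫⁻ x, g x = 0 := by
  -- By invariance of the volume, the space mean of each time average equals that of `g`, whereas a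
  -- finite forward mass sends the time averages to zero.
  have hmean : ∀ n : ℕ, ∫⁻ x, ((n : ℝ≥0∞) + 1)⁻¹ *
      ∫⁻ t in Set.Ioc (0 : ℝ) (n + 1), g (flow v t x) = ∫⁻ x, g x := fun n => by
    have hm := measurable_comp_flow hv hg
    rw [lintegral_const_mul _ (hm.lintegral_prod_right' (ν := volume.restrict _)),
      lintegral_lintegral_swap hm.aemeasurable]
    simp only [fun t => (measurePreserving_flow hv hdiv t).lintegral_comp hg]
    rw [lintegral_const, Measure.restrict_apply_univ, Real.volume_Ioc, sub_zero, mul_comm,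
      mul_assoc]
    have e : ENNReal.ofReal ((n : ℝ) + 1) = (n : ℝ≥0∞) + 1 := by
      rw [ENNReal.ofReal_add (Nat.cast_nonneg n) zero_le_one]
      simp
    rw [e, ENNReal.mul_inv_cancel (by simp) (by simp), mul_one]
  have hlim : Tendsto (fun n : ℕ => ∫⁻ x, ((n : ℝ≥0∞) + 1)⁻¹ *
      ∫⁻ t in Set.Ioc (0 : ℝ) (n + 1), g (flow v t x)) atTop (𝓝 (∫⁻ _ : Torus d, 0)) := by
    refine tendsto_lintegral_of_dominated_convergence (fun _ => 1) (fun n => ?_) (fun n => ?_)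
      (by simp) ?_
    · exact ((measurable_comp_flow hv hg).lintegral_prod_right'
        (ν := volume.restrict _)).const_mul _
    · refine ae_of_all _ fun x => ?_
      have h1 : ∫⁻ t in Set.Ioc (0 : ℝ) (n + 1), g (flow v t x) ≤ (n : ℝ≥0∞) + 1 := by
        calc ∫⁻ t in Set.Ioc (0 : ℝ) (n + 1), g (flow v t x)
            ≤ ∫⁻ _ in Set.Ioc (0 : ℝ) (n + 1), 1 := lintegral_mono fun t => hg1 _
          _ = (n : ℝ≥0∞) + 1 := by
            rw [setLIntegral_one, Real.volume_Ioc, sub_zero,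
              ENNReal.ofReal_add (Nat.cast_nonneg n) zero_le_one]
            simp
      calc ((n : ℝ≥0∞) + 1)⁻¹ * ∫⁻ t in Set.Ioc (0 : ℝ) (n + 1), g (flow v t x)
          ≤ ((n : ℝ≥0∞) + 1)⁻¹ * ((n : ℝ≥0∞) + 1) := by gcongr
        _ ≤ 1 := ENNReal.inv_mul_le_one _
    · filter_upwards [h] with x hx
      have h2 : Tendsto (fun n : ℕ => ((n : ℝ≥0∞) + 1)⁻¹ * forwardMass v g x) atTop (𝓝 0) := by
        have h3 : Tendsto (fun n : ℕ => ((n : ℝ≥0∞) + 1)⁻¹) atTop (𝓝 0) := by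
          have := (tendsto_add_atTop_iff_nat 1).2 ENNReal.tendsto_inv_nat_nhds_zero
          simpa using this
        simpa using ENNReal.Tendsto.mul_const h3 (Or.inr hx.ne)
      refine tendsto_of_tendsto_of_tendsto_of_le_of_le tendsto_const_nhds h2
        (fun _ => zero_le) fun n => ?_
      dsimp only
      gcongr
      exact lintegral_mono_set Set.Ioc_subset_Ioi_self
  simp only [hmean, lintegral_zero] at hlim
  exact tendsto_nhds_unique tendsto_const_nhds hlim

lemma ae_tendsto_of_ergodicFlow (hv : LipschitzWith K v) (hdiv : DivergenceFree v)
    {φ : Torus d → ℝ} (hφ : Integrable φ) (hφ0 : ∀ᵐ x, 0 ≤ φ x) (havg : 0 < ∫ x, φ x)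
    (herg : ErgodicFlow (flow v)) :
    ∀ᵐ x, Tendsto (fun t : ℝ => ∫ τ in (0 : ℝ)..t, φ (flow v τ x)) atTop atTop := by
  -- A Borel version of `φ` makes the set in the ergodicity test measurable, and the truncation at
  -- `1` makes it exactly invariant.
  set g : Torus d → ℝ≥0∞ := fun x => min (ENNReal.ofReal (hφ.aestronglyMeasurable.mk φ x)) 1
    with hg
  have hgm : Measurable g :=
    hφ.aestronglyMeasurable.stronglyMeasurable_mk.measurable.ennreal_ofReal.min measurable_const
  have hg1 : ∀ x, g x ≤ 1 := fun x => min_le_right _ _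
  have hgφ : ∀ᵐ x, g x = min (ENNReal.ofReal (φ x)) 1 := by
    filter_upwards [hφ.aestronglyMeasurable.ae_eq_mk] with x hx
    rw [hg, hx]
  have hgpos : ∫⁻ x, g x ≠ 0 := fun h0 => by
    rw [lintegral_eq_zero_iff hgm] at h0
    have : ∀ᵐ x, φ x = 0 := by
      filter_upwards [h0, hgφ, hφ0] with x h1 h2 h3
      rw [h1, Pi.zero_apply, eq_comm, min_eq_iff] at h2
      rcases h2 with h2 | h2
      · exact le_antisymm (ENNReal.ofReal_eq_zero.1 h2.1) h3
      · exact absurd h2.1 one_ne_zero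
    rw [integral_congr_ae this, integral_zero] at havg
    exact havg.false
  have hinf : ∀ᵐ x, forwardMass v g x = ⊤ := by
    have hB : MeasurableSet {x | forwardMass v g x < ⊤} :=
      measurableSet_lt (measurable_forwardMass hv hgm) measurable_const
    rcases herg _ hB (image_flow_forwardMass_lt_top hv hg1) with h | h
    · rw [ae_iff]
      simpa [lt_top_iff_ne_top] using h
    · refine absurd (lintegral_eq_zero_of_forwardMass_lt_top hv hdiv hgm hg1 ?_) hgpos
      exact (mem_ae_iff_prob_eq_one hB).2 h
  filter_upwards [hinf, ae_ae_comp_flow hv hdiv hφ0, ae_ae_comp_flow hv hdiv hgφ,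
    ae_forall_intervalIntegrable_comp_flow hv hdiv hφ] with x hx h0 hgx hi
  refine (tendsto_atTop_or_bounded hi h0).resolve_right ?_
  rintro ⟨b, hb⟩
  have h1 : forwardMass v g x ≤ ENNReal.ofReal b := by
    refine le_trans (lintegral_mono_ae (ae_restrict_of_ae ?_)) (lintegral_Ioi_le_of_bounded hi h0 hb)
    filter_upwards [hgx] with t ht
    rw [ht]
    exact min_le_left _ _
  rw [hx] at h1
  exact absurd h1 (not_le.2 ENNReal.ofReal_lt_top)

/-! ### Uniquely ergodic flows -/

/-- The uniform probability measure on the orbit segment of length `T` starting at `x`. -/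
def orbitMeasure (v : Torus d → Fin d → ℝ) (T : ℝ) (x : Torus d) : Measure (Torus d) :=
  ENNReal.ofReal T⁻¹ • Measure.map (fun t => flow v t x) (volume.restrict (Set.Ioc 0 T))

lemma continuous_flow_time (hv : LipschitzWith K v) (x : Torus d) :
    Continuous (fun t => flow v t x) :=
  (continuous_flow_uncurry hv).comp (by fun_prop : Continuous fun t : ℝ => (t, x))

lemma isProbabilityMeasure_orbitMeasure (hv : LipschitzWith K v) {T : ℝ} (hT : 0 < T)
    (x : Torus d) : IsProbabilityMeasure (orbitMeasure v T x) := by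
  refine ⟨?_⟩
  rw [orbitMeasure, Measure.smul_apply, Measure.map_apply
    (continuous_flow_time hv x).measurable MeasurableSet.univ]
  simp [← ENNReal.ofReal_mul (inv_nonneg.2 hT.le), inv_mul_cancel₀ hT.ne']

lemma integral_orbitMeasure (hv : LipschitzWith K v) {T : ℝ} (hT : 0 < T) (x : Torus d)
    {f : Torus d → ℝ} (hf : Continuous f) :
    ∫ y, f y ∂(orbitMeasure v T x) = T⁻¹ * ∫ t in (0 : ℝ)..T, f (flow v t x) := by
  rw [orbitMeasure, integral_smul_measure, integral_map
    (continuous_flow_time hv x).aemeasurable hf.aestronglyMeasurable,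
    intervalIntegral.integral_of_le hT.le, ENNReal.toReal_ofReal (inv_nonneg.2 hT.le), smul_eq_mul]

/-- The two integrals differ only by two end pieces of length `|r|`. -/
lemma abs_integral_shift_sub_le {f : ℝ → ℝ} (hf : Continuous f) {C : ℝ} (hC : ∀ t, |f t| ≤ C)
    (r T : ℝ) : |(∫ t in (0 : ℝ)..T, f (t + r)) - ∫ t in (0 : ℝ)..T, f t| ≤ 2 * C * |r| := by
  have hi : ∀ a b, IntervalIntegrable f volume a b := fun a b => hf.intervalIntegrable a b
  have e : (∫ t in (0 : ℝ)..T, f (t + r)) - ∫ t in (0 : ℝ)..T, f t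
      = (∫ t in T..(T + r), f t) - ∫ t in (0 : ℝ)..r, f t := by
    rw [intervalIntegral.integral_comp_add_right, zero_add,
      ← intervalIntegral.integral_add_adjacent_intervals (hi r 0) (hi 0 (T + r)),
      ← intervalIntegral.integral_add_adjacent_intervals (hi 0 T) (hi T (T + r)),
      intervalIntegral.integral_symm 0 r]
    ring
  have h1 := intervalIntegral.norm_integral_le_of_norm_le_const (a := T) (b := T + r)
    (f := f) (C := C) fun t _ => hC t
  have h2 := intervalIntegral.norm_integral_le_of_norm_le_const (a := 0) (b := r)
    (f := f) (C := C) fun t _ => hC t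
  rw [e]
  refine (abs_sub _ _).trans ?_
  simp only [Real.norm_eq_abs, add_sub_cancel_left, sub_zero] at h1 h2
  linarith

/-- Weak limits of orbit measures over longer and longer segments are invariant. -/
lemma measurePreserving_of_tendsto_orbitMeasure (hv : LipschitzWith K v) {T : ℕ → ℝ}
    (hT : ∀ n, 0 < T n) {F : Filter ℕ} [F.NeBot] (hTF : Tendsto T F atTop) {x : ℕ → Torus d}
    {m : Measure (Torus d)} [IsProbabilityMeasure m]
    (hm : ∀ f : Torus d → ℝ, Continuous f →
      Tendsto (fun n => ∫ y, f y ∂(orbitMeasure v (T n) (x n))) F (𝓝 (∫ y, f y ∂m))) (r : ℝ) :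
    MeasurePreserving (flow v r) m m := by
  have hc := continuous_flow hv r
  refine ⟨hc.measurable, ?_⟩
  have : IsProbabilityMeasure (Measure.map (flow v r) m) :=
    Measure.isProbabilityMeasure_map hc.aemeasurable
  refine ext_of_forall_integral_eq_of_IsFiniteMeasure fun f => ?_
  rw [integral_map hc.aemeasurable f.continuous.aestronglyMeasurable]
  obtain ⟨C, hC⟩ := exists_abs_le f.continuous
  have h1 := (hm (fun y => f (flow v r y)) (f.continuous.comp hc)).sub (hm f f.continuous)
  have h2 : Tendsto (fun n => (∫ y, f (flow v r y) ∂(orbitMeasure v (T n) (x n)))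
      - ∫ y, f y ∂(orbitMeasure v (T n) (x n))) F (𝓝 0) := by
    have h3 : Tendsto (fun n => (T n)⁻¹ * (2 * C * |r|)) F (𝓝 0) := by
      simpa using (tendsto_inv_atTop_zero.comp hTF).mul_const (2 * C * |r|)
    refine squeeze_zero_norm (fun n => ?_) h3
    rw [integral_orbitMeasure hv (hT n) _ f.continuous,
      integral_orbitMeasure hv (hT n) (x n)
        (f := fun y => f (flow v r y)) (f.continuous.comp hc), ← mul_sub, norm_mul,
      Real.norm_of_nonneg (inv_nonneg.2 (hT n).le)]
    refine mul_le_mul_of_nonneg_left ?_ (inv_nonneg.2 (hT n).le)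
    have := abs_integral_shift_sub_le (f.continuous.comp (continuous_flow_time hv (x n)))
      (fun t => hC _) r (T n)
    simpa only [Function.comp_apply, add_comm _ r, flow_add hv] using! this
  exact sub_eq_zero.1 (tendsto_nhds_unique h1 h2)

/-- Krylov–Bogoliubov by contradiction: orbit measures with mean of `φ` below `μ` and lengths
tending to infinity have an invariant limit. Unique ergodicity makes it the volume, while continuity
of `φ` keeps its mean at most `μ`. -/
lemma exists_time_le_integral_of_uniquelyErgodicFlow (hv : LipschitzWith K v)
    (hdiv : DivergenceFree v) {φ : Torus d → ℝ} (hφ : Continuous φ)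
    (hue : UniquelyErgodicFlow (flow v)) {μ : ℝ} (hμ : μ < ∫ x, φ x) :
    ∃ T₀ : ℝ, 0 < T₀ ∧ ∀ t, T₀ ≤ t → ∀ x, μ * t ≤ ∫ τ in (0 : ℝ)..t, φ (flow v τ x) := by
  by_contra! hcon
  choose T hT x hx using fun n : ℕ => hcon (n + 1) (by positivity)
  have hT0 : ∀ n, 0 < T n := fun n => lt_of_lt_of_le (by positivity) (hT n)
  have hTt : Tendsto T atTop atTop :=
    tendsto_atTop_mono (fun n => (by linarith [hT n] : (n : ℝ) ≤ T n)) tendsto_natCast_atTop_atTop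
  let P : ℕ → ProbabilityMeasure (Torus d) := fun n =>
    ⟨orbitMeasure v (T n) (x n), isProbabilityMeasure_orbitMeasure hv (hT0 n) (x n)⟩
  -- A nonprincipal ultrafilter takes the place of a convergent subsequence in the compact space of
  -- probability measures.
  obtain ⟨m, -, hm⟩ := (isCompact_univ (X := ProbabilityMeasure (Torus d))).ultrafilter_le_nhds
    ((hyperfilter ℕ).map P) (by simp)
  have hm' : Tendsto P (hyperfilter ℕ : Filter ℕ) (𝓝 m) := hm
  rw [ProbabilityMeasure.tendsto_iff_forall_integral_tendsto] at hm'
  have hmc : ∀ f : Torus d → ℝ, Continuous f →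
      Tendsto (fun n => ∫ y, f y ∂(orbitMeasure v (T n) (x n))) (hyperfilter ℕ : Filter ℕ)
        (𝓝 (∫ y, f y ∂(m : Measure (Torus d)))) := fun f hf =>
    hm' (BoundedContinuousFunction.mkOfCompact ⟨f, hf⟩)
  have hinv : ∀ t, MeasurePreserving (flow v t) (m : Measure (Torus d)) m :=
    measurePreserving_of_tendsto_orbitMeasure hv hT0 (hTt.mono_left Nat.hyperfilter_le_atTop) hmc
  have heq : (m : Measure (Torus d)) = volume :=
    hue.unique ⟨inferInstance, hinv⟩ ⟨inferInstance, measurePreserving_flow hv hdiv⟩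
  have hle : ∫ y, φ y ∂(m : Measure (Torus d)) ≤ μ := by
    refine le_of_tendsto' (hmc φ hφ) fun n => ?_
    rw [integral_orbitMeasure hv (hT0 n) _ hφ, inv_mul_le_iff₀ (hT0 n), mul_comm]
    exact (hx n).le
  rw [heq] at hle
  linarith

/-- A uniform lower bound for the accumulated damping gives exponential decay of all `Lᵖ`
norms. -/
lemma IsWeakSolution.eLpNorm_le (hv : LipschitzWith K v) (hdiv : DivergenceFree v)
    {φ θ₀ : Torus d → ℝ} {θ : ℝ → Torus d → ℝ} (hφ : Integrable φ) {p : ℝ≥0∞} (hp1 : 1 ≤ p)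
    (h₀ : MemLp θ₀ p volume) (hθ : IsWeakSolution v φ θ₀ θ) {μ t : ℝ} (ht : 0 ≤ t)
    (h : ∀ x, μ * t ≤ ∫ τ in (0 : ℝ)..t, φ (flow v τ x)) :
    eLpNorm (θ t) p volume ≤ eLpNorm θ₀ p volume * ENNReal.ofReal (Real.exp (-μ * t)) := by
  rw [mul_comm, ← eLpNorm_comp_measurePreserving (hθ.integrable_slice t ht).aestronglyMeasurable
    (measurePreserving_flow hv hdiv t)]
  refine eLpNorm_le_mul_eLpNorm_of_ae_le_mul ?_ p
  filter_upwards [hθ.ae_eq_exp hv hdiv hφ (h₀.integrable hp1) ht] with x hx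
  rw [Function.comp_apply, hx, norm_mul, mul_comm, Real.norm_of_nonneg (Real.exp_pos _).le]
  gcongr
  linarith [h x]

end DampedTransport

end

theorem theorem2p1 (d : ℕ) (hd : 1 ≤ d)
    (v : DampedTransport.Torus d → Fin d → ℝ) (hv : ∃ K : ℝ≥0, LipschitzWith K v)
    (hdiv : DampedTransport.DivergenceFree v)
    (φ : DampedTransport.Torus d → ℝ) (hφ_int : Integrable φ volume)
    (hφ_nonneg : ∀ᵐ x, 0 ≤ φ x) (hφ_avg : 0 < ∫ x, φ x) :
    -- (i) ergodic flows
    (DampedTransport.ErgodicFlow (DampedTransport.flow v) →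
      ∀ p : ℝ≥0∞, 1 ≤ p → p ≠ ⊤ →
      ∀ θ₀ : DampedTransport.Torus d → ℝ, MemLp θ₀ p volume →
      ∀ θ : ℝ → DampedTransport.Torus d → ℝ, DampedTransport.IsWeakSolution v φ θ₀ θ →
        Tendsto (fun t : ℝ => eLpNorm (θ t) p volume) atTop (𝓝 0)) ∧
    -- (ii) uniquely ergodic flows and continuous damping
    (DampedTransport.UniquelyErgodicFlow (DampedTransport.flow v) → Continuous φ →
      ∀ μ : ℝ, 0 ≤ μ → μ < ∫ x, φ x →
      ∃ T₀ : ℝ, 0 < T₀ ∧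
        ∀ p : ℝ≥0∞, 1 ≤ p →
        ∀ θ₀ : DampedTransport.Torus d → ℝ, MemLp θ₀ p volume →
        ∀ θ : ℝ → DampedTransport.Torus d → ℝ, DampedTransport.IsWeakSolution v φ θ₀ θ →
        ∀ t : ℝ, T₀ ≤ t →
          eLpNorm (θ t) p volume ≤ eLpNorm θ₀ p volume * ENNReal.ofReal (Real.exp (-μ * t))) ∧
    -- (iii) positive Birkhoff limit, no ergodicity
    ((∀ᵐ x, 0 < DampedTransport.birkhoffLimit (DampedTransport.flow v) φ x) →
      ∀ p : ℝ≥0∞, 1 ≤ p → p ≠ ⊤ →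
      ∀ θ₀ : DampedTransport.Torus d → ℝ, MemLp θ₀ p volume →
      ∀ θ : ℝ → DampedTransport.Torus d → ℝ, DampedTransport.IsWeakSolution v φ θ₀ θ →
        Tendsto (fun t : ℝ => eLpNorm (θ t) p volume) atTop (𝓝 0)) := by
  obtain ⟨K, hv⟩ := hv
  refine ⟨fun herg p hp1 hp θ₀ h₀ θ hθ => ?_, fun hue hφc μ _ hμ => ?_,
    fun hpos p hp1 hp θ₀ h₀ θ hθ => ?_⟩
  · exact hθ.tendsto_eLpNorm hv hdiv hφ_int hφ_nonneg
      (DampedTransport.ae_tendsto_of_ergodicFlow hv hdiv hφ_int hφ_nonneg hφ_avg herg) hp1 hp h₀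
  · obtain ⟨T₀, hT₀, h⟩ :=
      DampedTransport.exists_time_le_integral_of_uniquelyErgodicFlow hv hdiv hφc hue hμ
    exact ⟨T₀, hT₀, fun p hp1 θ₀ h₀ θ hθ t ht =>
      hθ.eLpNorm_le hv hdiv hφ_int hp1 h₀ (hT₀.le.trans ht) (h t ht)⟩
  · exact hθ.tendsto_eLpNorm hv hdiv hφ_int hφ_nonneg
      (DampedTransport.ae_tendsto_of_birkhoffLimit_pos hv hdiv hφ_int hφ_nonneg hpos) hp1 hp h₀
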